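/- Let $\mathsf x(t)=(\mathsf x_1(t),\dots,\mathsf x_M(t))$, $t\in\mathbb R$, be real, zero-mean, jointly wide-sense stationary processes with finite variances and integrable power spectral density matrix $C(f)\in\mathbb C^{M\times M}$, i.e. $\mathbb E\{\mathsf x_i(t+\tau)\mathsf x_j(t)\}=\int_{\mathbb R} C_{ij}(f)e^{j2\pi f\tau}\,df$. Let $\mathsf s\in\mathbb R^N$ be a zero-mean random vector with finite second moments whose MMSE estimate is linear: $\tilde{\mathsf s}=\mathbb E\{\mathsf s\mid \mathsf x\}=(\Gamma*\mathsf x)(0)$ for a filter with frequency response $\Gamma(f)\in\mathbb C^{N\times M}$. Let $f_s>0$ be an arbitrary sampling rate, $T_s=1/f_s$, and let $\mathsf x$ be bandlimited in the sense that $C(f)=0$ for $|f|>(\Upsilon+\tfrac12)f_s$, for some $\Upsilon\in\mathbb N$ (for $\Upsilon\ge1$ this includes sub-Nyquist sampling). Let $H(f)\in\mathbb C^{K\times M}$ be the frequency response of an analog filter with real impulse response and finite-variance output $\mathsf y=H*\mathsf x$, with samples $\mathsf y_k[n]=T_s\mathsf y_k(nT_s)$. Put $$\bar\Gamma(f)=\big[\Gamma(f-kf_s)\,C^{1/2}(f-kf_s)\big]_{k=-\Upsilon,\dots,\Upsilon},\qquad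 \bar H(f)=\big[H(f-kf_s)\,C^{1/2}(f-kf_s)\big]_{k=-\Upsilon,\dots,\Upsilon},$$ and assume that $H$ maintains sufficiency: for every $|f|\le f_s/2$ the column space of $\bar\Gamma^H(f)$ is contained in the column space of $\bar H^H(f)$. Fix $\eta>0$. For all sufficiently large $b\in\mathbb N$ let the quantizers have $b$ bits, dynamic range $\gamma_b>0$ and step $\Delta_b=2\gamma_b/2^b$, let the dither $\mathsf w^{(b)}_k[n]$ be i.i.d. in $k$ and $n$, independent of $\mathsf x$, with density $\frac1{\Delta_b}(1-|w|/\Delta_b)$ on $|w|\le\Delta_b$, and let $\gamma_b^2=\eta^2\max_k\mathbb E\{(\mathsf y_k[n]+\mathsf w_k^{(b)}[n])^2\}$. With $$S(f)=\sum_{k\in\mathbb Z}\Gamma(f-kf_s)C(f-kf_s)H^H(f-kf_s),\qquad C_{\mathsf z}(f)=T_s\sum_{k\in\mathbb Z}H(f-kf_s)C(f-kf_s)H^H(f-kf_s)+\tfrac{\Delta_b^2}{4}I_K,$$ the following hold. 1. The closed-form minimum achievable MSE tends to zero: $$\mathbb E\{\|\tilde{\mathsf s}\|^2\}-\mathrm{tr}\Big(T_s\int_{-f_s/2}^{f_s/2}S(f)C_{\mathsf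 z}^{-1}(f)S^H(f)\,df\Big)\;\longrightarrow\;0\qquad(b\to\infty).$$ 2. Suppose that for all large $b$ the quantizers do not overload, i.e. $\Pr\{|\mathsf y_k[n]+\mathsf w_k^{(b)}[n]|\ge\gamma_b\}=0$ for all $k,n$. Let $\mathsf z_k[n]$ be the output of the $b$-bit uniform mid-rise quantizer with dynamic range $\gamma_b$ for the input $\mathsf y_k[n]+\mathsf w^{(b)}_k[n]$. Then the smallest MSE achievable with linear digital recovery, $\inf_G\mathbb E\{\|\tilde{\mathsf s}-\hat{\mathsf s}\|^2\}$ over digital filters $G[n]\in\mathbb R^{N\times K}$ with $\hat{\mathsf s}=\sum_{n\in\mathbb Z}G[-n]\mathsf z[n]$ (convergent in mean square), tends to zero as $b\to\infty$. -/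

import Mathlib

open MeasureTheory ProbabilityTheory Filter Topology
open scoped Matrix ComplexOrder MatrixOrder

namespace TaskADC

noncomputable section

/-! ### Signal model -/

/-- The real processes `x 0, …, x (M-1)` are zero-mean, have finite variances and are jointly
wide-sense stationary with power spectral density matrix `C`:
`E[x_i(t+τ) x_j(t)] = ∫ C_{ij}(f) e^{2π𝑖fτ} df` for all `t`, `τ`. -/
structure IsWSSWithPSD {Ω : Type*} [MeasurableSpace Ω] (μ : Measure Ω) {M : ℕ}
    (x : Fin M → ℝ → Ω → ℝ) (C : ℝ → Matrix (Fin M) (Fin M) ℂ) : Prop where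
  measurable : ∀ m t, Measurable (x m t)
  memLp : ∀ m t, MemLp (x m t) 2 μ
  mean_zero : ∀ m t, ∫ ω, x m t ω ∂μ = 0
  posSemidef : ∀ f, (C f).PosSemidef
  integrable : ∀ i j, Integrable (fun f => C f i j)
  covariance : ∀ i j t τ, ((∫ ω, x i (t + τ) ω * x j t ω ∂μ : ℝ) : ℂ) =
    ∫ f : ℝ, C f i j * Complex.exp (2 * Real.pi * Complex.I * f * τ)

/-- The σ-algebra generated by the whole observed process `{x_m(t)}`. -/
abbrev signalAlgebra {Ω : Type*} {M : ℕ} (x : Fin M → ℝ → Ω → ℝ) : MeasurableSpace Ω :=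
  ⨆ m, ⨆ t, MeasurableSpace.comap (x m t) inferInstance

/-- Frequency response `∑_τ A(τ) e^{-2π𝑖fτ}` of the tapped delay line with impulse response
`∑_τ A(τ) δ(t - τ)` (finitely many real matrix taps). -/
def firResponse {K M : ℕ} (A : ℝ →₀ Matrix (Fin K) (Fin M) ℝ) (f : ℝ) :
    Matrix (Fin K) (Fin M) ℂ :=
  A.sum fun τ a => Complex.exp (-(2 * Real.pi * Complex.I * f * τ)) • a.map (fun r => (r : ℂ))

/-- Output `∑_τ A(τ) x(t - τ)` of that tapped delay line. -/
def firOutput {Ω : Type*} {K M : ℕ} (A : ℝ →₀ Matrix (Fin K) (Fin M) ℝ)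
    (x : Fin M → ℝ → Ω → ℝ) (k : Fin K) (t : ℝ) (ω : Ω) : ℝ :=
  A.sum fun τ a => ∑ m, a k m * x m (t - τ) ω

/-- `y = h * x`, where the real multivariate filter `h` has frequency response `H`.
For a stationary input with spectral density `C` the convolution is taken in mean square:
`y(t)` is the mean-square limit of the outputs of tapped delay lines whose frequency responses
converge to `H` in `L²(C(f) df)`.  This determines `y(t)` almost surely; it makes sense for every
frequency response whose output has finite variance, and it covers integrable impulse responses
as well as Dirac ones (such as `H(f) = I`) and ideal band filters. -/
def IsFilterOutput {Ω : Type*} [MeasurableSpace Ω] (μ : Measure Ω) {K M : ℕ}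
    (x : Fin M → ℝ → Ω → ℝ) (C : ℝ → Matrix (Fin M) (Fin M) ℂ)
    (H : ℝ → Matrix (Fin K) (Fin M) ℂ) (y : Fin K → ℝ → Ω → ℝ) : Prop :=
  (∀ k t, MemLp (y k t) 2 μ) ∧
  ∃ A : ℕ → (ℝ →₀ Matrix (Fin K) (Fin M) ℝ),
    Tendsto (fun j => ∫⁻ f : ℝ, ENNReal.ofReal
      ((firResponse (A j) f - H f) * C f * (firResponse (A j) f - H f)ᴴ).trace.re)
      atTop (𝓝 0) ∧
    ∀ k t, Tendsto (fun j => ∫ ω, (y k t ω - firOutput (A j) x k t ω) ^ 2 ∂μ) atTop (𝓝 0)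

/-- The analog MMSE estimate `s̃ = E[s | {x_m(t)}]`, componentwise. -/
def mmse {Ω : Type*} [MeasurableSpace Ω] (μ : Measure Ω) {M N : ℕ}
    (x : Fin M → ℝ → Ω → ℝ) (s : Fin N → Ω → ℝ) (i : Fin N) : Ω → ℝ :=
  μ[s i | signalAlgebra x]

/-- The MMSE estimate is linear in the observations: `s̃ = (Γ * x)(0)`. -/
def HasLinearMMSE {Ω : Type*} [MeasurableSpace Ω] (μ : Measure Ω) {M N : ℕ}
    (x : Fin M → ℝ → Ω → ℝ) (C : ℝ → Matrix (Fin M) (Fin M) ℂ)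
    (s : Fin N → Ω → ℝ) (Γ : ℝ → Matrix (Fin N) (Fin M) ℂ) : Prop :=
  ∃ v : Fin N → ℝ → Ω → ℝ, IsFilterOutput μ x C Γ v ∧ ∀ i, mmse μ x s i =ᵐ[μ] v i 0

/-! ### Sampling and quantization -/

/-- The samples `y_k[n] = T_s y_k(n T_s)`, with `T_s = 1 / f_s`. -/
def sample {Ω : Type*} {K : ℕ} (fs : ℝ) (y : Fin K → ℝ → Ω → ℝ) (k : Fin K) (n : ℤ) (ω : Ω) : ℝ :=
  1 / fs * y k (n * (1 / fs)) ω

/-- Quantization step `Δ = 2γ / 2^b` of a `b`-bit quantizer with dynamic range `γ`. -/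
def step (γ : ℝ) (b : ℕ) : ℝ := 2 * γ / 2 ^ b

/-- The uniform scalar mid-rise quantizer with `b` bits and dynamic range `γ`. -/
def midRise (γ : ℝ) (b : ℕ) (v : ℝ) : ℝ :=
  if |v| < γ then step γ b * (⌊v / step γ b⌋ + 1 / 2)
  else SignType.sign v * (γ - step γ b / 2)

/-- The triangular probability density of width `2Δ`. -/
def triangularPDF (Δ v : ℝ) : ℝ := if |v| ≤ Δ then 1 / Δ * (1 - |v| / Δ) else 0

/-- `w` is a dither process with step `Δ`: i.i.d. in time and space, with triangular density of
width `2Δ`, and independent of the input process `x`. -/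
structure IsDither {Ω : Type*} [MeasurableSpace Ω] (μ : Measure Ω) {K M : ℕ}
    (x : Fin M → ℝ → Ω → ℝ) (Δ : ℝ) (w : Fin K → ℤ → Ω → ℝ) : Prop where
  measurable : ∀ k n, Measurable (w k n)
  law : ∀ k n, μ.map (w k n) = volume.withDensity fun v => ENNReal.ofReal (triangularPDF Δ v)
  iid : iIndepFun (fun p : Fin K × ℤ => w p.1 p.2) μ
  indep_input : Indep (⨆ k, ⨆ n, MeasurableSpace.comap (w k n) inferInstance)
    (signalAlgebra x) μ

/-- The dynamic range is `η` times the largest standard deviation of the (dithered) quantizer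
inputs `u`: `γ > 0` and `γ² = η² max_k E[u_k[n]²]`. -/
def IsDynamicRange {Ω : Type*} [MeasurableSpace Ω] (μ : Measure Ω) {K : ℕ}
    (η : ℝ) (u : Fin K → ℤ → Ω → ℝ) (γ : ℝ) : Prop :=
  0 < γ ∧ ∀ n, γ ^ 2 = η ^ 2 * ⨆ k, ∫ ω, u k n ω ^ 2 ∂μ

/-- The quantizer inputs never reach the dynamic range (zero overload probability). -/
def NoOverload {Ω : Type*} [MeasurableSpace Ω] (μ : Measure Ω) {K : ℕ}
    (u : Fin K → ℤ → Ω → ℝ) (γ : ℝ) : Prop :=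
  ∀ k n, μ {ω | γ ≤ |u k n ω|} = 0

/-! ### Digital recovery -/

/-- `ŝ = ∑_n G[-n] z[n] = (G * z)[0]`, the series converging in mean square. -/
def IsDigitalEstimate {Ω : Type*} [MeasurableSpace Ω] (μ : Measure Ω) {K N : ℕ}
    (z : Fin K → ℤ → Ω → ℝ) (G : ℤ → Matrix (Fin N) (Fin K) ℝ) (sHat : Fin N → Ω → ℝ) : Prop :=
  ∀ i, MemLp (sHat i) 2 μ ∧
    Tendsto (fun F : Finset ℤ =>
      ∫ ω, (sHat i ω - ∑ n ∈ F, ∑ k, G (-n) i k * z k n ω) ^ 2 ∂μ) atTop (𝓝 0)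

/-- The MSE achievable by linear digital recovery from the quantized samples `z`:
the infimum of `E‖s̃ - ŝ‖²` over all digital filters `G`. -/
def achievableMSE {Ω : Type*} [MeasurableSpace Ω] (μ : Measure Ω) {K N : ℕ}
    (sTilde : Fin N → Ω → ℝ) (z : Fin K → ℤ → Ω → ℝ) : ℝ :=
  sInf {r | ∃ G sHat, IsDigitalEstimate μ z G sHat ∧
    r = ∑ i, ∫ ω, (sTilde i ω - sHat i ω) ^ 2 ∂μ}

/-- `S(f) = ∑_{k ∈ ℤ} Γ(f - k f_s) C(f - k f_s) H(f - k f_s)ᴴ`. -/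
def aliasedCross {N K M : ℕ} (C : ℝ → Matrix (Fin M) (Fin M) ℂ)
    (Γ : ℝ → Matrix (Fin N) (Fin M) ℂ) (H : ℝ → Matrix (Fin K) (Fin M) ℂ) (fs f : ℝ) :
    Matrix (Fin N) (Fin K) ℂ :=
  ∑' k : ℤ, Γ (f - k * fs) * C (f - k * fs) * (H (f - k * fs))ᴴ

/-- Spectral density of the quantized samples:
`C_z = T_s ∑_{k ∈ ℤ} H(f - k f_s) C(f - k f_s) H(f - k f_s)ᴴ + (Δ²/4) I`. -/
def quantizedPSD {K M : ℕ} (C : ℝ → Matrix (Fin M) (Fin M) ℂ)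
    (H : ℝ → Matrix (Fin K) (Fin M) ℂ) (fs Δ f : ℝ) : Matrix (Fin K) (Fin K) ℂ :=
  ((1 / fs : ℝ) : ℂ) • aliasedCross C H H fs f + ((Δ ^ 2 / 4 : ℝ) : ℂ) • 1

/-- Closed form of the minimum achievable MSE,
`E‖s̃‖² - tr (T_s ∫_{-f_s/2}^{f_s/2} S(f) C_z(f)⁻¹ S(f)ᴴ df)`. -/
def closedFormMSE {Ω : Type*} [MeasurableSpace Ω] (μ : Measure Ω) {N K M : ℕ}
    (sTilde : Fin N → Ω → ℝ) (C : ℝ → Matrix (Fin M) (Fin M) ℂ)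
    (Γ : ℝ → Matrix (Fin N) (Fin M) ℂ) (H : ℝ → Matrix (Fin K) (Fin M) ℂ) (fs Δ : ℝ) : ℝ :=
  (∑ i, ∫ ω, sTilde i ω ^ 2 ∂μ) -
    (((1 / fs : ℝ) : ℂ) * ∫ f in (-(fs / 2))..(fs / 2),
      (aliasedCross C Γ H fs f * (quantizedPSD C H fs Δ f)⁻¹ *
        (aliasedCross C Γ H fs f)ᴴ).trace).re

/-! ### Sufficiency -/

/-- The block matrix `[F_{-Υ}(f) L_{-Υ}(f), …, F_Υ(f) L_Υ(f)]` with `F_k(f) = F(f - k f_s)` and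
`L_k(f) = C(f - k f_s)^{1/2}`; the columns are indexed by pairs (shift `k`, input `m`). -/
def stacked {P M : ℕ} (C : ℝ → Matrix (Fin M) (Fin M) ℂ) (F : ℝ → Matrix (Fin P) (Fin M) ℂ)
    (fs : ℝ) (Υ : ℕ) (f : ℝ) : Matrix (Fin P) (Set.Icc (-(Υ : ℤ)) Υ × Fin M) ℂ :=
  Matrix.of fun p km =>
    (F (f - (km.1 : ℤ) * fs) * CFC.sqrt (C (f - (km.1 : ℤ) * fs))) p km.2

/-- `H` maintains sufficiency with respect to `s̃ = (Γ * x)(0)`: for every `|f| ≤ f_s/2` the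
column space of the stacked matrix `Γ̄(f)ᴴ` is contained in the column space of `H̄(f)ᴴ`. -/
def MaintainsSufficiency {N K M : ℕ} (C : ℝ → Matrix (Fin M) (Fin M) ℂ)
    (Γ : ℝ → Matrix (Fin N) (Fin M) ℂ) (H : ℝ → Matrix (Fin K) (Fin M) ℂ)
    (fs : ℝ) (Υ : ℕ) : Prop :=
  ∀ f ∈ Set.Icc (-(fs / 2)) (fs / 2),
    LinearMap.range (stacked C Γ fs Υ f)ᴴ.mulVecLin ≤
      LinearMap.range (stacked C H fs Υ f)ᴴ.mulVecLin

end

end TaskADC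

/-! Both claims reduce to a least squares problem at each frequency. The spectral isometry
(`IsSpectralRep.secondMoment_eq`) identifies the mean square of a variable obtained linearly from
`x` with the energy `∫ R C Rᴴ` of its frequency response `R`; a digital filter acting on the samples
contributes an `fs`-periodic row `g` multiplying `H`. Folding the frequency axis onto one Nyquist
interval, where band limitation leaves `2Υ + 1` aliases, turns the recovery error of component `i`
into an integral over `|f| ≤ fs/2`: at each `f`, one row `g f` has to fit all aliases of the row `Γ
f i` at once. Sufficiency makes this finite-dimensional problem solvable with zero error
(`MaintainsSufficiency.exists_aliasError_eq_zero`).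

For the first claim, the term `Δ²/4` in the sample spectrum acts as a ridge penalty `δ = fs Δ²/4`.
Completing the square (`ridge_identity`) shows that the closed form is the integral of the penalized
minima (`closedFormMSE_eq`). If `h` fits exactly, the minimum is at most `δ‖h‖²`, so it vanishes
pointwise with `δ`; it never exceeds the error of the zero filter, which is integrable because the
estimate has finite variance. Dominated convergence finishes (`tendsto_integral_aliasMin`), once
`tendsto_step` has shown `Δ → 0` even though `γ` itself depends on the dither.

For the second claim, the exact fits need not depend on `f` boundedly or measurably. Truncated ridge
solutions replace them, and trigonometric polynomials, that is, filters with finitely many real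
taps, approximate those (`exists_filter_integral_sq_le`). Without overload the quantized samples lie
almost surely within `3Δ/2` of the true ones. The taps are fixed before `b` grows, so this bound
alone makes the effect of quantization vanish. -/

namespace TaskADC

noncomputable section

/-! ### Hermitian forms on row vectors -/

section Energy

variable {ι κ : Type*} [Fintype ι] [Fintype κ]

/-- The sesquilinear form `a C bᴴ` of two row vectors. -/
def hform (C : Matrix ι ι ℂ) (a b : ι → ℂ) : ℂ := a ⬝ᵥ C *ᵥ star b

/-- The quadratic form `a C aᴴ` of a row vector. -/
def energy (C : Matrix ι ι ℂ) (a : ι → ℂ) : ℝ := (hform C a a).re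

lemma hform_add_left (C : Matrix ι ι ℂ) (a b c : ι → ℂ) :
    hform C (a + b) c = hform C a c + hform C b c := by
  simp [hform, add_dotProduct]

lemma hform_add_right (C : Matrix ι ι ℂ) (a b c : ι → ℂ) :
    hform C a (b + c) = hform C a b + hform C a c := by
  simp [hform, Matrix.mulVec_add, dotProduct_add]

lemma hform_smul_left (C : Matrix ι ι ℂ) (r : ℂ) (a b : ι → ℂ) :
    hform C (r • a) b = r * hform C a b := by
  simp [hform]

lemma hform_smul_right (C : Matrix ι ι ℂ) (r : ℂ) (a b : ι → ℂ) :
    hform C a (r • b) = star r * hform C a b := by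
  simp [hform, Matrix.mulVec_smul]

lemma hform_sub_left (C : Matrix ι ι ℂ) (a b c : ι → ℂ) :
    hform C (a - b) c = hform C a c - hform C b c := by
  simp [hform, sub_dotProduct]

lemma hform_sub_right (C : Matrix ι ι ℂ) (a b c : ι → ℂ) :
    hform C a (b - c) = hform C a b - hform C a c := by
  simp [hform, Matrix.mulVec_sub, dotProduct_sub]

lemma hform_eq_sum (C : Matrix ι ι ℂ) (a b : ι → ℂ) :
    hform C a b = ∑ i, ∑ j, a i * C i j * star (b j) := by
  simp [hform, dotProduct, Matrix.mulVec, Finset.mul_sum, mul_assoc]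

lemma hform_star {C : Matrix ι ι ℂ} (hC : C.IsHermitian) (a b : ι → ℂ) :
    star (hform C a b) = hform C b a := by
  rw [hform, ← Matrix.star_dotProduct_star, Matrix.star_mulVec, hC.eq, star_star,
    ← Matrix.dotProduct_mulVec, hform]

lemma hform_re_comm {C : Matrix ι ι ℂ} (hC : C.IsHermitian) (a b : ι → ℂ) :
    (hform C a b).re = (hform C b a).re := by
  rw [← hform_star hC a b]; simp

lemma hform_self {C : Matrix ι ι ℂ} (hC : C.IsHermitian) (a : ι → ℂ) :
    hform C a a = energy C a := by
  have h := hform_star hC a a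
  exact (Complex.conj_eq_iff_re.1 h).symm

lemma energy_nonneg {C : Matrix ι ι ℂ} (hC : C.PosSemidef) (a : ι → ℂ) : 0 ≤ energy C a := by
  have h := hC.dotProduct_mulVec_nonneg (star a)
  rw [star_star] at h
  exact (Complex.le_def.1 h).1

@[simp] lemma energy_zero (C : Matrix ι ι ℂ) : energy C 0 = 0 := by simp [energy, hform]

@[simp] lemma energy_zero_matrix (a : ι → ℂ) : energy (0 : Matrix ι ι ℂ) a = 0 := by
  simp [energy, hform]

lemma energy_smul (C : Matrix ι ι ℂ) (r : ℂ) (a : ι → ℂ) :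
    energy C (r • a) = ‖r‖ ^ 2 * energy C a := by
  have : r * star r = ((‖r‖ ^ 2 : ℝ) : ℂ) := by
    simpa using Complex.mul_conj' r
  rw [energy, hform_smul_left, hform_smul_right, ← mul_assoc, this, Complex.re_ofReal_mul, energy]

lemma energy_neg (C : Matrix ι ι ℂ) (a : ι → ℂ) : energy C (-a) = energy C a := by
  simpa using energy_smul C (-1) a

lemma energy_add {C : Matrix ι ι ℂ} (hC : C.IsHermitian) (a b : ι → ℂ) :
    energy C (a + b) = energy C a + 2 * (hform C a b).re + energy C b := by
  simp only [energy, hform_add_left, hform_add_right, Complex.add_re, hform_re_comm hC b a]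
  ring

lemma energy_sub {C : Matrix ι ι ℂ} (hC : C.IsHermitian) (a b : ι → ℂ) :
    energy C (a - b) = energy C a - 2 * (hform C a b).re + energy C b := by
  simp only [energy, hform_sub_left, hform_sub_right, Complex.sub_re, hform_re_comm hC b a]
  ring

lemma energy_sub_comm (C : Matrix ι ι ℂ) (a b : ι → ℂ) : energy C (a - b) = energy C (b - a) := by
  rw [← energy_neg, neg_sub]

/-- Young's inequality, from nonnegativity of the energy of `ε • a - b` divided by `ε`. The free `ε`
allows a factor arbitrarily close to one on the main term, which the isometry needs in the limit. -/
lemma energy_add_le {C : Matrix ι ι ℂ} (hC : C.PosSemidef) {ε : ℝ} (hε : 0 < ε) (a b : ι → ℂ) :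
    energy C (a + b) ≤ (1 + ε) * energy C a + (1 + ε⁻¹) * energy C b := by
  have h := energy_nonneg hC ((ε : ℂ) • a - b)
  rw [energy_sub hC.1, energy_smul, hform_smul_left, Complex.re_ofReal_mul, Complex.norm_real,
    Real.norm_of_nonneg hε.le] at h
  have h' : 0 ≤ ε⁻¹ * (ε ^ 2 * energy C a - 2 * (ε * (hform C a b).re) + energy C b) := by
    positivity
  have e : ε⁻¹ * (ε ^ 2 * energy C a - 2 * (ε * (hform C a b).re) + energy C b) =
      ε * energy C a - 2 * (hform C a b).re + ε⁻¹ * energy C b := by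
    field_simp
  rw [energy_add hC.1]
  linarith

lemma energy_add_le_two {C : Matrix ι ι ℂ} (hC : C.PosSemidef) (a b : ι → ℂ) :
    energy C (a + b) ≤ 2 * energy C a + 2 * energy C b := by
  have := energy_add_le hC one_pos a b
  norm_num at this
  exact this

/-- The constant is crude: each added term costs a factor two. Only its independence of the vectors
matters. -/
lemma energy_sum_le {C : Matrix ι ι ℂ} (hC : C.PosSemidef) {β : Type*} (s : Finset β)
    (a : β → ι → ℂ) : energy C (∑ p ∈ s, a p) ≤ 2 ^ s.card * ∑ p ∈ s, energy C (a p) := by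
  classical
  induction s using Finset.induction_on with
  | empty => simp
  | insert p s hp ih =>
    rw [Finset.sum_insert hp, Finset.sum_insert hp, Finset.card_insert_of_notMem hp]
    have h1 := energy_add_le_two hC (a p) (∑ q ∈ s, a q)
    have h2 := energy_nonneg hC (a p)
    have h3 : (1 : ℝ) ≤ 2 ^ s.card := one_le_pow₀ one_le_two
    rw [pow_succ]
    nlinarith

lemma energy_eq_trace (C : Matrix ι ι ℂ) (A : Matrix κ ι ℂ) :
    (A * C * Aᴴ).trace = ∑ k, hform C (A k) (A k) := by
  refine Finset.sum_congr rfl fun k _ => ?_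
  rw [hform_eq_sum, Matrix.diag_apply, Matrix.mul_apply, Finset.sum_comm]
  simp [Matrix.mul_apply, Finset.sum_mul]

lemma energy_le_trace {C : Matrix ι ι ℂ} (hC : C.PosSemidef) (A : Matrix κ ι ℂ) (k : κ) :
    energy C (A k) ≤ (A * C * Aᴴ).trace.re := by
  rw [energy_eq_trace, Complex.re_sum]
  exact Finset.single_le_sum (f := fun k => energy C (A k)) (fun i _ => energy_nonneg hC _)
    (Finset.mem_univ k)

lemma energy_mul_self_eq_zero {C L : Matrix ι ι ℂ} (h : L * L = C) {a : ι → ℂ}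
    (ha : a ᵥ* L = 0) : energy C a = 0 := by
  rw [energy, hform, ← h, ← Matrix.mulVec_mulVec, Matrix.dotProduct_mulVec, ha, zero_dotProduct,
    Complex.zero_re]

end Energy

/-! ### Regularized least squares -/

section Ridge

variable {κ : Type*} [DecidableEq κ]

lemma posDef_add_smul_one {P : Matrix κ κ ℂ} (hP : P.PosSemidef) {δ : ℝ} (hδ : 0 < δ) :
    (P + (δ : ℂ) • 1).PosDef :=
  Matrix.PosDef.posSemidef_add hP (Matrix.PosDef.one.smul (by simpa using hδ))

variable [Fintype κ]

/-- The minimizer `σ (P + δ)⁻¹` of `α - 2 Re(σ hᴴ) + h P hᴴ + δ ‖h‖²`. -/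
def ridgeSol (σ : κ → ℂ) (P : Matrix κ κ ℂ) (δ : ℝ) : κ → ℂ := σ ᵥ* (P + (δ : ℂ) • 1)⁻¹

/-- The minimum of `α - 2 Re(σ hᴴ) + h P hᴴ + δ ‖h‖²`. -/
def ridgeMin (α : ℝ) (σ : κ → ℂ) (P : Matrix κ κ ℂ) (δ : ℝ) : ℝ :=
  α - (hform (P + (δ : ℂ) • 1)⁻¹ σ σ).re

lemma energy_add_smul_one (P : Matrix κ κ ℂ) (δ : ℝ) (h : κ → ℂ) :
    energy (P + (δ : ℂ) • 1) h = energy P h + δ * ∑ k, ‖h k‖ ^ 2 := by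
  have : h ⬝ᵥ star h = ((∑ k, ‖h k‖ ^ 2 : ℝ) : ℂ) := by
    simp [dotProduct, Complex.mul_conj']
  rw [energy, hform, Matrix.add_mulVec, dotProduct_add, Complex.add_re, Matrix.smul_mulVec,
    Matrix.one_mulVec, dotProduct_smul, this, smul_eq_mul, ← Complex.ofReal_mul, Complex.ofReal_re]
  rfl

/-- Completing the square: `ridgeSol` represents the linear functional given by `σ` in the form of
`P + δ`, so the cross term is absorbed. -/
lemma ridge_identity (α : ℝ) (σ : κ → ℂ) {P : Matrix κ κ ℂ} (hP : P.PosSemidef) {δ : ℝ}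
    (hδ : 0 < δ) (h : κ → ℂ) :
    α - 2 * (σ ⬝ᵥ star h).re + energy P h + δ * ∑ k, ‖h k‖ ^ 2 =
      ridgeMin α σ P δ + energy (P + (δ : ℂ) • 1) (h - ridgeSol σ P δ) := by
  have hD := posDef_add_smul_one hP hδ
  have hu : IsUnit (P + (δ : ℂ) • 1).det := (Matrix.isUnit_iff_isUnit_det _).1 hD.isUnit
  have e1 : ∀ v, hform (P + (δ : ℂ) • 1) (ridgeSol σ P δ) v = σ ⬝ᵥ star v := fun v => by
    rw [hform, ridgeSol, ← Matrix.dotProduct_mulVec, Matrix.mulVec_mulVec,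
      Matrix.nonsing_inv_mul _ hu, Matrix.one_mulVec]
  have e2 : energy (P + (δ : ℂ) • 1) (ridgeSol σ P δ) = (hform (P + (δ : ℂ) • 1)⁻¹ σ σ).re := by
    rw [energy, e1, ridgeSol, Matrix.star_vecMul, hD.1.inv.eq, hform]
  rw [energy_sub hD.1, e2, hform_re_comm hD.1, e1, ridgeMin, energy_add_smul_one]
  ring

end Ridge

/-! ### Joint least squares over finitely many aliases. -/

section Alias

variable {ι κ β : Type*} [Fintype ι] [Fintype κ]

/-- Least squares error of the joint approximation of the rows `a k` by `h B k`. -/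
def fitError (s : Finset β) (C : β → Matrix ι ι ℂ) (a : β → ι → ℂ) (B : β → Matrix κ ι ℂ)
    (h : κ → ℂ) : ℝ := ∑ k ∈ s, energy (C k) (a k - h ᵥ* B k)

/-- The row vector `∑ a C Bᴴ`. -/
def crossRow (s : Finset β) (C : β → Matrix ι ι ℂ) (a : β → ι → ℂ) (B : β → Matrix κ ι ℂ) :
    κ → ℂ := ∑ k ∈ s, a k ᵥ* (C k * (B k)ᴴ)

/-- The Gram matrix `∑ B C Bᴴ`. -/
def gram (s : Finset β) (C : β → Matrix ι ι ℂ) (B : β → Matrix κ ι ℂ) : Matrix κ κ ℂ :=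
  ∑ k ∈ s, B k * C k * (B k)ᴴ

variable {s : Finset β} {C : β → Matrix ι ι ℂ} {a : β → ι → ℂ} {B : β → Matrix κ ι ℂ}

lemma gram_posSemidef (hC : ∀ k, (C k).PosSemidef) : (gram s C B).PosSemidef :=
  Matrix.posSemidef_sum _ fun k _ => (hC k).mul_mul_conjTranspose_same (B k)

lemma energy_gram (h : κ → ℂ) : energy (gram s C B) h = ∑ k ∈ s, energy (C k) (h ᵥ* B k) := by
  simp only [energy, hform, gram, Matrix.sum_mulVec, dotProduct_sum, Complex.re_sum]
  refine Finset.sum_congr rfl fun k _ => ?_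
  rw [Matrix.star_vecMul, ← Matrix.mulVec_mulVec, ← Matrix.mulVec_mulVec, Matrix.dotProduct_mulVec]

lemma fitError_eq (hC : ∀ k, (C k).PosSemidef) (h : κ → ℂ) :
    fitError s C a B h = fitError s C a B 0 - 2 * (crossRow s C a B ⬝ᵥ star h).re +
      energy (gram s C B) h := by
  have : ∀ k, hform (C k) (a k) (h ᵥ* B k) = (a k ᵥ* (C k * (B k)ᴴ)) ⬝ᵥ star h := fun k => by
    rw [hform, Matrix.star_vecMul, Matrix.mulVec_mulVec, Matrix.dotProduct_mulVec]
  rw [energy_gram, crossRow, sum_dotProduct, Complex.re_sum]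
  simp only [fitError, Matrix.zero_vecMul, sub_zero, energy_sub (hC _).1, this,
    Finset.sum_add_distrib, Finset.sum_sub_distrib, Finset.mul_sum]

lemma fitError_nonneg (hC : ∀ k, (C k).PosSemidef) (h : κ → ℂ) : 0 ≤ fitError s C a B h :=
  Finset.sum_nonneg fun k _ => energy_nonneg (hC k) _

variable [DecidableEq κ]

/-- The regularized least squares error. -/
def fitMin (s : Finset β) (C : β → Matrix ι ι ℂ) (a : β → ι → ℂ) (B : β → Matrix κ ι ℂ)
    (δ : ℝ) : ℝ := ridgeMin (fitError s C a B 0) (crossRow s C a B) (gram s C B) δ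

/-- The regularized least squares solution. -/
def fitSol (s : Finset β) (C : β → Matrix ι ι ℂ) (a : β → ι → ℂ) (B : β → Matrix κ ι ℂ)
    (δ : ℝ) : κ → ℂ := ridgeSol (crossRow s C a B) (gram s C B) δ

lemma fit_identity (hC : ∀ k, (C k).PosSemidef) {δ : ℝ} (hδ : 0 < δ) (h : κ → ℂ) :
    fitError s C a B h + δ * ∑ k, ‖h k‖ ^ 2 = fitMin s C a B δ +
      energy (gram s C B + (δ : ℂ) • 1) (h - fitSol s C a B δ) := by
  rw [fitError_eq hC, ridge_identity _ _ (gram_posSemidef hC) hδ]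
  rfl

lemma fit_sol (hC : ∀ k, (C k).PosSemidef) {δ : ℝ} (hδ : 0 < δ) :
    fitError s C a B (fitSol s C a B δ) + δ * ∑ k, ‖fitSol s C a B δ k‖ ^ 2 =
      fitMin s C a B δ := by
  rw [fit_identity hC hδ]; simp

lemma fitMin_le (hC : ∀ k, (C k).PosSemidef) {δ : ℝ} (hδ : 0 < δ) (h : κ → ℂ) :
    fitMin s C a B δ ≤ fitError s C a B h + δ * ∑ k, ‖h k‖ ^ 2 := by
  rw [fit_identity hC hδ]
  have := energy_nonneg (posDef_add_smul_one (gram_posSemidef hC (s := s) (B := B)) hδ).posSemidef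
    (h - fitSol s C a B δ)
  linarith

lemma fitMin_le_fitError_zero (hC : ∀ k, (C k).PosSemidef) {δ : ℝ} (hδ : 0 < δ) :
    fitMin s C a B δ ≤ fitError s C a B 0 := by
  simpa using fitMin_le hC hδ (a := a) (s := s) (B := B) 0

lemma fitError_sol_le (hC : ∀ k, (C k).PosSemidef) {δ : ℝ} (hδ : 0 < δ) :
    fitError s C a B (fitSol s C a B δ) ≤ fitMin s C a B δ := by
  rw [← fit_sol hC hδ]
  have : 0 ≤ δ * ∑ k, ‖fitSol s C a B δ k‖ ^ 2 := by positivity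
  linarith

lemma fitMin_nonneg (hC : ∀ k, (C k).PosSemidef) {δ : ℝ} (hδ : 0 < δ) :
    0 ≤ fitMin s C a B δ :=
  (fitError_nonneg hC _).trans (fitError_sol_le hC hδ)

/-- The penalty paid by the minimizer is at most the total cost of the zero row. This growth rate in
`δ⁻¹` later decides the truncation level. -/
lemma norm_fitSol_sq_le (hC : ∀ k, (C k).PosSemidef) {δ : ℝ} (hδ : 0 < δ) (k : κ) :
    ‖fitSol s C a B δ k‖ ^ 2 ≤ δ⁻¹ * fitError s C a B 0 := by
  have h1 := fit_sol hC hδ (a := a) (s := s) (B := B)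
  have h2 := fitError_nonneg hC (s := s) (a := a) (B := B) (fitSol s C a B δ)
  have h3 := fitMin_le_fitError_zero hC hδ (a := a) (s := s) (B := B)
  have h4 : ‖fitSol s C a B δ k‖ ^ 2 ≤ ∑ k, ‖fitSol s C a B δ k‖ ^ 2 :=
    Finset.single_le_sum (f := fun k => ‖fitSol s C a B δ k‖ ^ 2) (fun i _ => by positivity)
      (Finset.mem_univ k)
  rw [le_inv_mul_iff₀ hδ]
  nlinarith

/-- An exact fit `h` is a competitor whose only cost is the penalty `δ‖h‖²`. No rate or uniformity
in the data is claimed. -/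
lemma tendsto_fitMin {h : κ → ℂ} (hC : ∀ k, (C k).PosSemidef) (hh : fitError s C a B h = 0)
    {γ : Type*} {l : Filter γ} {δ : γ → ℝ} (hδ : ∀ᶠ n in l, 0 < δ n) (hl : Tendsto δ l (𝓝 0)) :
    Tendsto (fun n => fitMin s C a B (δ n)) l (𝓝 0) := by
  refine tendsto_of_tendsto_of_tendsto_of_le_of_le' tendsto_const_nhds
    (h := fun n => δ n * ∑ k, ‖h k‖ ^ 2) ?_ ?_ ?_
  · simpa using hl.mul_const (∑ k, ‖h k‖ ^ 2)
  · filter_upwards [hδ] with n hn using fitMin_nonneg hC hn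
  · filter_upwards [hδ] with n hn
    simpa [hh] using fitMin_le hC hn (a := a) (s := s) (B := B) h

end Alias

/-! ### Spectral representation -/

section Spectral

open scoped ENNReal

lemma aemeasurable_hform {X ι : Type*} [MeasurableSpace X] [Fintype ι] {ν : Measure X}
    {C : X → Matrix ι ι ℂ} {a b : X → ι → ℂ} (hC : ∀ i j, AEMeasurable (fun t => C t i j) ν)
    (ha : ∀ i, AEMeasurable (fun t => a t i) ν) (hb : ∀ i, AEMeasurable (fun t => b t i) ν) :
    AEMeasurable (fun t => hform (C t) (a t) (b t)) ν := by
  simp only [hform_eq_sum]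
  refine Finset.aemeasurable_fun_sum _ fun i _ => Finset.aemeasurable_fun_sum _ fun j _ => ?_
  exact ((ha i).mul (hC i j)).mul (Complex.continuous_conj.measurable.comp_aemeasurable (hb j))

lemma aemeasurable_energy {X ι : Type*} [MeasurableSpace X] [Fintype ι] {ν : Measure X}
    {C : X → Matrix ι ι ℂ} {a : X → ι → ℂ} (hC : ∀ i j, AEMeasurable (fun t => C t i j) ν)
    (ha : ∀ i, AEMeasurable (fun t => a t i) ν) :
    AEMeasurable (fun t => energy (C t) (a t)) ν :=
  Complex.measurable_re.comp_aemeasurable (aemeasurable_hform hC ha ha)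

lemma enorm_sq_eq_ofReal (z : ℂ) : ‖z‖ₑ ^ 2 = ENNReal.ofReal (‖z‖ ^ 2) := by
  rw [← ofReal_norm, ENNReal.ofReal_pow (norm_nonneg z)]

lemma norm_add_sq_le {ε : ℝ} (hε : 0 < ε) (a b : ℂ) :
    ‖a + b‖ ^ 2 ≤ (1 + ε) * ‖a‖ ^ 2 + (1 + ε⁻¹) * ‖b‖ ^ 2 := by
  have h1 : ‖a + b‖ ^ 2 ≤ (‖a‖ + ‖b‖) ^ 2 := by gcongr; exact norm_add_le a b
  have h2 : 0 ≤ ε⁻¹ * (ε * ‖a‖ - ‖b‖) ^ 2 := by positivity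
  have h3 : ε⁻¹ * (ε * ‖a‖ - ‖b‖) ^ 2 = ε * ‖a‖ ^ 2 - 2 * ‖a‖ * ‖b‖ + ε⁻¹ * ‖b‖ ^ 2 := by
    field_simp
    ring
  linarith

/-- The square accounts for two successive uses of the triangle inequality with factor `1 + ε`. -/
lemma le_of_forall_one_add_sq_mul {a b : ℝ≥0∞}
    (h : ∀ ε : ℝ, 0 < ε → a ≤ ENNReal.ofReal ((1 + ε) ^ 2) * b) : a ≤ b := by
  have h1 : Tendsto (fun ε : ℝ => ENNReal.ofReal ((1 + ε) ^ 2) * b) (𝓝[>] 0)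
      (𝓝 (ENNReal.ofReal ((1 + 0) ^ 2) * b)) := by
    refine ENNReal.Tendsto.mul_const ?_ (Or.inl (by simp))
    refine (ENNReal.continuous_ofReal.tendsto _).comp ?_
    have : Continuous fun ε : ℝ => (1 + ε) ^ 2 := by fun_prop
    exact (this.tendsto 0).mono_left nhdsWithin_le_nhds
  have h2 : ENNReal.ofReal ((1 + 0) ^ 2) * b = b := by simp
  rw [h2] at h1
  exact ge_of_tendsto h1 (by filter_upwards [self_mem_nhdsWithin] with ε hε using h ε hε)

variable {Ω : Type*} {M : ℕ}
  {x : Fin M → ℝ → Ω → ℝ} {C : ℝ → Matrix (Fin M) (Fin M) ℂ}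

/-- The character `f ↦ e^{2π𝑖ft}`. -/
def char (t f : ℝ) : ℂ := Complex.exp (2 * Real.pi * Complex.I * f * t)

lemma continuous_char (t : ℝ) : Continuous (char t) := by unfold char; fun_prop

@[simp] lemma norm_char (t f : ℝ) : ‖char t f‖ = 1 := by
  rw [char, show (2 * Real.pi * Complex.I * f * t : ℂ) = ((2 * Real.pi * f * t : ℝ) : ℂ) * Complex.I
    by push_cast; ring, Complex.norm_exp_ofReal_mul_I]

lemma char_add (s t f : ℝ) : char (s + t) f = char s f * char t f := by
  rw [char, char, char, ← Complex.exp_add]; push_cast; ring_nf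

lemma char_mul_star (s t f : ℝ) : char s f * star (char t f) = char (s - t) f := by
  have h : star (char t f) = char (-t) f := by
    change (starRingEnd ℂ) (char t f) = _
    rw [char, char, ← Complex.exp_conj]
    simp [map_ofNat]
  rw [h, ← char_add, sub_eq_add_neg]

variable (M) in
/-- Frequency response `∑ c_{m,t} e^{2π𝑖ft} e_m` of the combination `∑ c_{m,t} x_m(t)`. -/
def comboResponse : ((Fin M × ℝ) →₀ ℂ) →ₗ[ℂ] (ℝ → Fin M → ℂ) :=
  Finsupp.linearCombination ℂ fun p f => Pi.single p.1 (char p.2 f)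

/-- The combination `∑ c_{m,t} x_m(t)`. -/
def comboOutput (x : Fin M → ℝ → Ω → ℝ) : ((Fin M × ℝ) →₀ ℂ) →ₗ[ℂ] (Ω → ℂ) :=
  Finsupp.linearCombination ℂ fun p ω => (x p.1 p.2 ω : ℂ)

lemma comboResponse_apply (c : (Fin M × ℝ) →₀ ℂ) (f : ℝ) :
    comboResponse M c f = ∑ p ∈ c.support, c p • Pi.single p.1 (char p.2 f) := by
  simp [comboResponse, Finsupp.linearCombination_apply, Finsupp.sum]

lemma comboOutput_apply (c : (Fin M × ℝ) →₀ ℂ) (ω : Ω) :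
    comboOutput x c ω = ∑ p ∈ c.support, c p * x p.1 p.2 ω := by
  simp [comboOutput, Finsupp.linearCombination_apply, Finsupp.sum]

lemma measurable_comboResponse (c : (Fin M × ℝ) →₀ ℂ) (m : Fin M) :
    Measurable fun f => comboResponse M c f m := by
  simp only [comboResponse_apply, Finset.sum_apply, Pi.smul_apply, smul_eq_mul]
  refine Finset.measurable_fun_sum _ fun p _ => Measurable.const_mul ?_ _
  by_cases h : m = p.1
  · subst h; simpa using (continuous_char _).measurable
  · simp [h]

lemma hform_sum_smul {ι β : Type*} [Fintype ι] (A : Matrix ι ι ℂ) (s : Finset β) (c : β → ℂ)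
    (v : β → ι → ℂ) : hform A (∑ p ∈ s, c p • v p) (∑ p ∈ s, c p • v p) =
      ∑ p ∈ s, ∑ q ∈ s, c p * star (c q) * hform A (v p) (v q) := by
  simp only [hform, star_sum, Matrix.mulVec_sum, sum_dotProduct, dotProduct_sum, star_smul,
    Matrix.mulVec_smul, smul_dotProduct, dotProduct_smul, smul_eq_mul, Finset.mul_sum]
  rw [Finset.sum_comm]
  exact Finset.sum_congr rfl fun p _ => Finset.sum_congr rfl fun q _ => by ring

variable [MeasurableSpace Ω] {μ : Measure Ω}

lemma IsWSSWithPSD.memLp_comboOutput (hx : IsWSSWithPSD μ x C) (c : (Fin M × ℝ) →₀ ℂ) :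
    MemLp (comboOutput x c) 2 μ := by
  have : comboOutput x c = fun ω => ∑ p ∈ c.support, c p * x p.1 p.2 ω :=
    funext fun ω => comboOutput_apply c ω
  rw [this]
  exact memLp_finsetSum _ fun p _ => (hx.memLp p.1 p.2).ofReal.const_mul _

lemma IsWSSWithPSD.integrable_mul_char (hx : IsWSSWithPSD μ x C) (i j : Fin M) (t : ℝ) :
    Integrable fun f => C f i j * char t f :=
  (hx.integrable i j).mul_bdd (c := 1) (continuous_char t).aestronglyMeasurable
    (Eventually.of_forall fun f => (norm_char t f).le)

/-- The form depends on the two times only through their difference, matching the stationarity of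
the covariance. -/
lemma hform_single (A : Matrix (Fin M) (Fin M) ℂ) (p q : Fin M × ℝ) (f : ℝ) :
    hform A (Pi.single p.1 (char p.2 f)) (Pi.single q.1 (char q.2 f)) =
      A p.1 q.1 * char (p.2 - q.2) f := by
  rw [← char_mul_star, hform_eq_sum, Finset.sum_eq_single p.1, Finset.sum_eq_single q.1]
  · simp only [Pi.single_eq_same]; ring
  · intro b _ hb; simp [hb]
  · simp
  · intro b _ hb; simp [hb]
  · simp

/-- The isometry between combinations of samples and their frequency responses. -/
lemma IsWSSWithPSD.lintegral_comboOutput (hx : IsWSSWithPSD μ x C) (c : (Fin M × ℝ) →₀ ℂ) :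
    ∫⁻ ω, ‖comboOutput x c ω‖ₑ ^ 2 ∂μ =
      ∫⁻ f, ENNReal.ofReal (energy (C f) (comboResponse M c f)) := by
  have hE : ∀ f, hform (C f) (comboResponse M c f) (comboResponse M c f) =
      ∑ p ∈ c.support, ∑ q ∈ c.support, c p * star (c q) *
        (C f p.1 q.1 * char (p.2 - q.2) f) := fun f => by
    rw [comboResponse_apply, hform_sum_smul]
    simp only [hform_single]
  have hI : ∀ p q : Fin M × ℝ, Integrable fun f => c p * star (c q) *
      (C f p.1 q.1 * char (p.2 - q.2) f) := fun p q =>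
    (hx.integrable_mul_char p.1 q.1 _).const_mul _
  have hEi : Integrable fun f => hform (C f) (comboResponse M c f) (comboResponse M c f) := by
    simp only [hE]
    exact integrable_finsetSum _ fun p _ => integrable_finsetSum _ fun q _ => hI p q
  have hO : ∀ ω, ((‖comboOutput x c ω‖ ^ 2 : ℝ) : ℂ) =
      ∑ p ∈ c.support, ∑ q ∈ c.support, c p * star (c q) *
        ((x p.1 p.2 ω * x q.1 q.2 ω : ℝ) : ℂ) := fun ω => by
    rw [Complex.ofReal_pow, ← Complex.mul_conj', comboOutput_apply, map_sum, Finset.sum_mul_sum]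
    refine Finset.sum_congr rfl fun p _ => Finset.sum_congr rfl fun q _ => ?_
    rw [map_mul, Complex.conj_ofReal, Complex.ofReal_mul]
    change _ = c p * (starRingEnd ℂ) (c q) * _
    ring
  have hJ : ∀ p q : Fin M × ℝ, Integrable (fun ω => c p * star (c q) *
      ((x p.1 p.2 ω * x q.1 q.2 ω : ℝ) : ℂ)) μ := fun p q =>
    ((hx.memLp p.1 p.2).integrable_mul (hx.memLp q.1 q.2)).ofReal.const_mul _
  have hcov : ∀ p q : Fin M × ℝ, ∫ ω, ((x p.1 p.2 ω * x q.1 q.2 ω : ℝ) : ℂ) ∂μ =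
      ∫ f, C f p.1 q.1 * char (p.2 - q.2) f := fun p q => by
    have := hx.covariance p.1 q.1 q.2 (p.2 - q.2)
    rw [add_sub_cancel] at this
    rw [integral_complex_ofReal]
    exact this
  -- Both sides expand into the same double sum over pairs `p, q`; the covariance formula with lag
  -- `p.2 - q.2` matches them term by term.
  have key : ((∫ ω, ‖comboOutput x c ω‖ ^ 2 ∂μ : ℝ) : ℂ) =
      ∫ f, hform (C f) (comboResponse M c f) (comboResponse M c f) := by
    rw [← integral_complex_ofReal]
    simp only [hE]
    rw [integral_congr_ae (Eventually.of_forall hO), integral_finsetSum _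
      fun p _ => integrable_finsetSum _ fun q _ => hJ p q, integral_finsetSum _
      fun p _ => integrable_finsetSum _ fun q _ => hI p q]
    refine Finset.sum_congr rfl fun p _ => ?_
    rw [integral_finsetSum _ fun q _ => hJ p q, integral_finsetSum _ fun q _ => hI p q]
    refine Finset.sum_congr rfl fun q _ => ?_
    rw [integral_const_mul, integral_const_mul, hcov]
  have key' : ∫ ω, ‖comboOutput x c ω‖ ^ 2 ∂μ =
      ∫ f, energy (C f) (comboResponse M c f) := by
    have h := congrArg Complex.re key
    rw [Complex.ofReal_re, ← RCLike.re_eq_complex_re, ← integral_re hEi] at h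
    exact h
  have hEr : Integrable fun f => energy (C f) (comboResponse M c f) := hEi.re
  simp only [enorm_sq_eq_ofReal]
  rw [← ofReal_integral_eq_lintegral_ofReal ((memLp_two_iff_integrable_sq_norm
    (hx.memLp_comboOutput c).1).1 (hx.memLp_comboOutput c))
    (Eventually.of_forall fun ω => by positivity), ← ofReal_integral_eq_lintegral_ofReal hEr
    (Eventually.of_forall fun f => energy_nonneg (hx.posSemidef f) _)]
  rw [key']

end Spectral

/-! ### Random variables attached to frequency responses, and the extended isometry. -/

section SpectralRep

open scoped ENNReal

variable {Ω : Type*} [MeasurableSpace Ω] {μ : Measure Ω} {M : ℕ}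
  {x : Fin M → ℝ → Ω → ℝ} {C : ℝ → Matrix (Fin M) (Fin M) ℂ}

/-- Weighted energy `∫ R C Rᴴ` of a row valued frequency response. -/
def totalEnergy (C : ℝ → Matrix (Fin M) (Fin M) ℂ) (R : ℝ → Fin M → ℂ) : ℝ≥0∞ :=
  ∫⁻ f, ENNReal.ofReal (energy (C f) (R f))

/-- Second moment of a complex random variable. -/
def secondMoment (μ : Measure Ω) (u : Ω → ℂ) : ℝ≥0∞ := ∫⁻ ω, ‖u ω‖ₑ ^ 2 ∂μ

lemma secondMoment_add_le {ε : ℝ} (hε : 0 < ε) {u : Ω → ℂ} (hu : AEMeasurable u μ) (v : Ω → ℂ) :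
    secondMoment μ (u + v) ≤ ENNReal.ofReal (1 + ε) * secondMoment μ u +
      ENNReal.ofReal (1 + ε⁻¹) * secondMoment μ v := by
  rw [secondMoment, secondMoment, secondMoment, ← lintegral_const_mul' _ _ ENNReal.ofReal_ne_top,
    ← lintegral_const_mul' _ _ ENNReal.ofReal_ne_top, ← lintegral_add_left' (by fun_prop)]
  refine lintegral_mono fun ω => ?_
  have h1 : 0 ≤ 1 + ε := by positivity
  have h2 : 0 ≤ 1 + ε⁻¹ := by positivity
  simp only [enorm_sq_eq_ofReal]
  rw [← ENNReal.ofReal_mul h1, ← ENNReal.ofReal_mul h2, ← ENNReal.ofReal_add (by positivity)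
    (by positivity)]
  exact ENNReal.ofReal_le_ofReal (norm_add_sq_le hε _ _)

lemma secondMoment_sub_comm (u v : Ω → ℂ) : secondMoment μ (u - v) = secondMoment μ (v - u) := by
  simp only [secondMoment, Pi.sub_apply, enorm_sub_rev]

lemma secondMoment_smul (r : ℂ) (u : Ω → ℂ) :
    secondMoment μ (r • u) = ‖r‖ₑ ^ 2 * secondMoment μ u := by
  rw [secondMoment, secondMoment, ← lintegral_const_mul' _ _ (by simp)]
  simp [mul_pow]

lemma IsWSSWithPSD.aemeasurable_energy (hx : IsWSSWithPSD μ x C) {R : ℝ → Fin M → ℂ}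
    (hR : ∀ m, Measurable fun f => R f m) : AEMeasurable fun f => energy (C f) (R f) :=
  TaskADC.aemeasurable_energy (fun i j => (hx.integrable i j).aemeasurable)
    fun m => (hR m).aemeasurable

lemma IsWSSWithPSD.totalEnergy_add_le (hx : IsWSSWithPSD μ x C) {ε : ℝ} (hε : 0 < ε)
    {R : ℝ → Fin M → ℂ} (hR : ∀ m, Measurable fun f => R f m) (T : ℝ → Fin M → ℂ) :
    totalEnergy C (R + T) ≤ ENNReal.ofReal (1 + ε) * totalEnergy C R +
      ENNReal.ofReal (1 + ε⁻¹) * totalEnergy C T := by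
  rw [totalEnergy, totalEnergy, totalEnergy, ← lintegral_const_mul' _ _ ENNReal.ofReal_ne_top,
    ← lintegral_const_mul' _ _ ENNReal.ofReal_ne_top, ← lintegral_add_left'
      ((hx.aemeasurable_energy hR).ennreal_ofReal.const_mul _)]
  refine lintegral_mono fun f => ?_
  have h1 : 0 ≤ 1 + ε := by positivity
  have h2 : 0 ≤ 1 + ε⁻¹ := by positivity
  have h3 := energy_nonneg (hx.posSemidef f) (R f)
  have h4 := energy_nonneg (hx.posSemidef f) (T f)
  rw [← ENNReal.ofReal_mul h1, ← ENNReal.ofReal_mul h2, ← ENNReal.ofReal_add (by positivity)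
    (by positivity)]
  exact ENNReal.ofReal_le_ofReal (energy_add_le (hx.posSemidef f) hε _ _)

lemma totalEnergy_sub_comm (R T : ℝ → Fin M → ℂ) :
    totalEnergy C (R - T) = totalEnergy C (T - R) := by
  simp only [totalEnergy, Pi.sub_apply, energy_sub_comm]

lemma totalEnergy_smul (r : ℂ) (R : ℝ → Fin M → ℂ) :
    totalEnergy C (r • R) = ‖r‖ₑ ^ 2 * totalEnergy C R := by
  rw [totalEnergy, totalEnergy, ← lintegral_const_mul' _ _ (by simp)]
  refine lintegral_congr fun f => ?_
  rw [Pi.smul_apply, energy_smul, ENNReal.ofReal_mul (by positivity), enorm_sq_eq_ofReal]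

/-- `u` is the random variable with frequency response `R`: a mean-square limit of combinations
of the `x_m(t)` whose responses converge to `R` in `L²(C(f) df)`. -/
structure IsSpectralRep (μ : Measure Ω) (x : Fin M → ℝ → Ω → ℝ)
    (C : ℝ → Matrix (Fin M) (Fin M) ℂ) (u : Ω → ℂ) (R : ℝ → Fin M → ℂ) : Prop where
  aemeasurable : AEMeasurable u μ
  measurable : ∀ m, Measurable fun f => R f m
  approx : ∃ c : ℕ → (Fin M × ℝ) →₀ ℂ,
    Tendsto (fun j => totalEnergy C (comboResponse M (c j) - R)) atTop (𝓝 0) ∧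
    Tendsto (fun j => secondMoment μ (comboOutput x (c j) - u)) atTop (𝓝 0)

lemma tendsto_zero_of_le_combination {a b d : ℕ → ℝ≥0∞} {r t : ℝ}
    (hb : Tendsto b atTop (𝓝 0)) (hd : Tendsto d atTop (𝓝 0))
    (h : ∀ j, a j ≤ ENNReal.ofReal r * b j + ENNReal.ofReal t * d j) : Tendsto a atTop (𝓝 0) := by
  refine tendsto_of_tendsto_of_tendsto_of_le_of_le tendsto_const_nhds
    (h := fun j => ENNReal.ofReal r * b j + ENNReal.ofReal t * d j) ?_ (fun _ => zero_le) h
  have h1 := ENNReal.Tendsto.const_mul (a := ENNReal.ofReal r) hb (Or.inr ENNReal.ofReal_ne_top)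
  have h2 := ENNReal.Tendsto.const_mul (a := ENNReal.ofReal t) hd (Or.inr ENNReal.ofReal_ne_top)
  simpa using h1.add h2

/-- Two families with equal values and small errors have equal limits. -/
lemma le_of_approx {X Y : ℝ≥0∞} {a b u v : ℕ → ℝ≥0∞} (ha : Tendsto a atTop (𝓝 0))
    (hb : Tendsto b atTop (𝓝 0)) (huv : ∀ j, u j = v j)
    (h1 : ∀ ε : ℝ, 0 < ε → ∀ j, X ≤ ENNReal.ofReal (1 + ε) * u j + ENNReal.ofReal (1 + ε⁻¹) * a j)
    (h2 : ∀ ε : ℝ, 0 < ε → ∀ j, v j ≤ ENNReal.ofReal (1 + ε) * Y + ENNReal.ofReal (1 + ε⁻¹) * b j) :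
    X ≤ Y := by
  refine le_of_forall_one_add_sq_mul fun ε hε => ?_
  -- Chain the two bounds at a fixed `ε`. Letting `j → ∞` removes the error terms, despite their
  -- large factors `1 + ε⁻¹`, before `ε → 0`.
  have h : ∀ j, X ≤ ENNReal.ofReal (1 + ε) * (ENNReal.ofReal (1 + ε) * Y +
      ENNReal.ofReal (1 + ε⁻¹) * b j) + ENNReal.ofReal (1 + ε⁻¹) * a j := fun j => by
    refine (h1 ε hε j).trans ?_
    rw [huv j]
    gcongr
    exact h2 ε hε j
  have hb' := ENNReal.Tendsto.const_mul (a := ENNReal.ofReal (1 + ε⁻¹)) hb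
    (Or.inr ENNReal.ofReal_ne_top)
  have ha' := ENNReal.Tendsto.const_mul (a := ENNReal.ofReal (1 + ε⁻¹)) ha
    (Or.inr ENNReal.ofReal_ne_top)
  have hlim := (ENNReal.Tendsto.const_mul (a := ENNReal.ofReal (1 + ε))
    ((tendsto_const_nhds (x := ENNReal.ofReal (1 + ε) * Y)).add hb')
    (Or.inr ENNReal.ofReal_ne_top)).add ha'
  refine (ge_of_tendsto' hlim h).trans (le_of_eq ?_)
  rw [mul_zero, add_zero, add_zero, ← mul_assoc, ← ENNReal.ofReal_mul (by positivity), sq]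

namespace IsSpectralRep

variable {u v : Ω → ℂ} {R T : ℝ → Fin M → ℂ}

lemma add (hx : IsWSSWithPSD μ x C) (hu : IsSpectralRep μ x C u R)
    (hv : IsSpectralRep μ x C v T) : IsSpectralRep μ x C (u + v) (R + T) := by
  obtain ⟨c, hc1, hc2⟩ := hu.approx
  obtain ⟨d, hd1, hd2⟩ := hv.approx
  refine ⟨hu.aemeasurable.add hv.aemeasurable,
    fun m => (hu.measurable m).add (hv.measurable m), fun j => c j + d j, ?_, ?_⟩
  · refine tendsto_zero_of_le_combination (r := 1 + 1) (t := 1 + 1⁻¹) hc1 hd1 fun j => ?_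
    rw [map_add, add_sub_add_comm]
    exact hx.totalEnergy_add_le one_pos
      (fun m => (measurable_comboResponse _ m).sub (hu.measurable m)) _
  · refine tendsto_zero_of_le_combination (r := 1 + 1) (t := 1 + 1⁻¹) hc2 hd2 fun j => ?_
    rw [map_add, add_sub_add_comm]
    exact secondMoment_add_le one_pos
      ((hx.memLp_comboOutput _).1.aemeasurable.sub hu.aemeasurable) _

lemma smul (r : ℂ) (hu : IsSpectralRep μ x C u R) :
    IsSpectralRep μ x C (r • u) (r • R) := by
  obtain ⟨c, hc1, hc2⟩ := hu.approx
  refine ⟨hu.aemeasurable.const_smul r, fun m => (hu.measurable m).const_smul r,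
    fun j => r • c j, ?_, ?_⟩
  · simp only [map_smul, ← smul_sub, totalEnergy_smul]
    simpa using ENNReal.Tendsto.const_mul (a := ‖r‖ₑ ^ 2) hc1 (Or.inr (by simp))
  · simp only [map_smul, ← smul_sub, secondMoment_smul]
    simpa using ENNReal.Tendsto.const_mul (a := ‖r‖ₑ ^ 2) hc2 (Or.inr (by simp))

lemma zero : IsSpectralRep μ x C (0 : Ω → ℂ) 0 :=
  ⟨aemeasurable_const, fun _ => measurable_const, fun _ => 0, by simp [totalEnergy],
    by simp [secondMoment]⟩

lemma sum_smul (hx : IsWSSWithPSD μ x C) {β : Type*} (s : Finset β) (r : β → ℂ) {u : β → Ω → ℂ}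
    {R : β → ℝ → Fin M → ℂ} (h : ∀ b ∈ s, IsSpectralRep μ x C (u b) (R b)) :
    IsSpectralRep μ x C (∑ b ∈ s, r b • u b) (∑ b ∈ s, r b • R b) := by
  classical
  induction s using Finset.induction_on with
  | empty => simpa using zero
  | insert b s hb ih =>
    rw [Finset.sum_insert hb, Finset.sum_insert hb]
    exact ((h b (Finset.mem_insert_self b s)).smul (r b)).add hx
      (ih fun c hc => h c (Finset.mem_insert_of_mem hc))

lemma sub (hx : IsWSSWithPSD μ x C) (hu : IsSpectralRep μ x C u R)
    (hv : IsSpectralRep μ x C v T) : IsSpectralRep μ x C (u - v) (R - T) := by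
  simpa [sub_eq_add_neg] using hu.add hx (hv.smul (-1))

/-- The second moment is the energy of the frequency response. -/
lemma secondMoment_eq (hx : IsWSSWithPSD μ x C) (hu : IsSpectralRep μ x C u R) :
    secondMoment μ u = totalEnergy C R := by
  obtain ⟨c, hc1, hc2⟩ := hu.approx
  have hiso : ∀ j, secondMoment μ (comboOutput x (c j)) = totalEnergy C (comboResponse M (c j)) :=
    fun j => hx.lintegral_comboOutput (c j)
  -- The isometry holds exactly for finite combinations. Comparing the limit with its approximants
  -- in both directions carries it over.
  refine le_antisymm (le_of_approx hc2 hc1 hiso (fun ε hε j => ?_) fun ε hε j => ?_)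
    (le_of_approx hc1 hc2 (fun j => (hiso j).symm) (fun ε hε j => ?_) fun ε hε j => ?_)
  · rw [secondMoment_sub_comm]
    simpa using secondMoment_add_le hε (hx.memLp_comboOutput (c j)).1.aemeasurable
      (u - comboOutput x (c j))
  · simpa using hx.totalEnergy_add_le hε hu.measurable (comboResponse M (c j) - R)
  · rw [totalEnergy_sub_comm]
    simpa using hx.totalEnergy_add_le hε (measurable_comboResponse (c j))
      (R - comboResponse M (c j))
  · simpa using secondMoment_add_le hε hu.aemeasurable (comboOutput x (c j) - u)

end IsSpectralRep

/-- Samples of a filter output have a spectral representation. -/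
lemma IsFilterOutput.isSpectralRep (hx : IsWSSWithPSD μ x C) {K : ℕ}
    {H : ℝ → Matrix (Fin K) (Fin M) ℂ} (hHm : ∀ k m, Measurable fun f => H f k m)
    {y : Fin K → ℝ → Ω → ℝ} (hy : IsFilterOutput μ x C H y) (k : Fin K) (t : ℝ) :
    IsSpectralRep μ x C (fun ω => (y k t ω : ℂ)) (fun f => char t f • H f k) := by
  obtain ⟨hyL, A, hA1, hA2⟩ := hy
  -- Row `k` of the delay line, read at time `t`: the tap at delay `τ` sees `x m (t - τ)`.
  let c : ℕ → (Fin M × ℝ) →₀ ℂ := fun j =>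
    ∑ τ ∈ (A j).support, ∑ m, Finsupp.single (m, t - τ) (A j τ k m : ℂ)
  have hres : ∀ j f, comboResponse M (c j) f = char t f • firResponse (A j) f k := fun j f => by
    have h1 : comboResponse M (c j) = ∑ τ ∈ (A j).support, ∑ m, (A j τ k m : ℂ) •
        fun f => (Pi.single m (char (t - τ) f) : Fin M → ℂ) := by
      simp only [c, map_sum, comboResponse, Finsupp.linearCombination_single]
    have h2 : ∀ τ : ℝ, char (t - τ) f = char t f * Complex.exp (-(2 * Real.pi * Complex.I * f * τ)) :=
      fun τ => by
        rw [char, char, ← Complex.exp_add]; push_cast; ring_nf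
    ext m
    rw [h1]
    simp only [Finset.sum_apply, Pi.smul_apply, smul_eq_mul, firResponse, Finsupp.sum, Matrix.sum_apply,
      Matrix.smul_apply, Matrix.map_apply, Finset.mul_sum]
    refine Finset.sum_congr rfl fun τ _ => ?_
    rw [Finset.sum_eq_single m (fun b _ hb => by simp [Ne.symm hb]) (by simp), Pi.single_eq_same, h2]
    ring
  have hout : ∀ j ω, comboOutput x (c j) ω = (firOutput (A j) x k t ω : ℂ) := fun j ω => by
    have h1 : comboOutput x (c j) = ∑ τ ∈ (A j).support, ∑ m, (A j τ k m : ℂ) •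
        fun ω => (x m (t - τ) ω : ℂ) := by
      simp only [c, map_sum, comboOutput, Finsupp.linearCombination_single]
    rw [h1]
    simp [firOutput, Finsupp.sum]
  refine ⟨(hyL k t).1.aemeasurable.complex_ofReal, fun m =>
    (continuous_char t).measurable.mul (hHm k m), c, ?_, ?_⟩
  -- The time shift has modulus one, and the energy of a single row is dominated by the trace over
  -- all rows.
  · refine tendsto_of_tendsto_of_tendsto_of_le_of_le tendsto_const_nhds hA1 (fun _ => zero_le)
      fun j => lintegral_mono fun f => ENNReal.ofReal_le_ofReal ?_
    rw [Pi.sub_apply, hres, ← smul_sub, energy_smul, norm_char, one_pow, one_mul]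
    exact energy_le_trace (hx.posSemidef f) (firResponse (A j) f - H f) k
  · have hL : ∀ j, MemLp (fun ω => y k t ω - firOutput (A j) x k t ω) 2 μ := fun j => by
      refine (hyL k t).sub ?_
      change MemLp (fun ω => firOutput (A j) x k t ω) 2 μ
      simp only [firOutput, Finsupp.sum]
      exact memLp_finsetSum _ fun τ _ => memLp_finsetSum _ fun m _ => (hx.memLp _ _).const_mul _
    have h := (ENNReal.continuous_ofReal.tendsto 0).comp (hA2 k t)
    rw [ENNReal.ofReal_zero] at h
    refine h.congr fun j => ?_
    rw [Function.comp_apply, ofReal_integral_eq_lintegral_ofReal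
      ((memLp_two_iff_integrable_sq (hL j).1).1 (hL j)) (Eventually.of_forall fun ω => sq_nonneg _)]
    refine lintegral_congr fun ω => ?_
    rw [enorm_sq_eq_ofReal, Pi.sub_apply, hout, ← Complex.ofReal_sub, Complex.norm_real,
      Real.norm_eq_abs, sq_abs, ← neg_sub, neg_sq]

/-- Finite output variance, moved through the isometry. For `Γ` this supplies the dominating
function; for `H` it makes the spectral weights of the samples finite measures. -/
lemma IsFilterOutput.totalEnergy_ne_top (hx : IsWSSWithPSD μ x C) {K : ℕ}
    {H : ℝ → Matrix (Fin K) (Fin M) ℂ} (hHm : ∀ k m, Measurable fun f => H f k m)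
    {y : Fin K → ℝ → Ω → ℝ} (hy : IsFilterOutput μ x C H y) (k : Fin K) :
    totalEnergy C (fun f => H f k) ≠ ∞ := by
  have h := (hy.isSpectralRep hx hHm k 0).secondMoment_eq hx
  have h0 : (fun f => char 0 f • H f k) = fun f => H f k := by
    funext f; simp [char]
  rw [h0] at h
  rw [← h, secondMoment]
  simp only [enorm_sq_eq_ofReal, Complex.norm_real, Real.norm_eq_abs, sq_abs]
  exact ((memLp_two_iff_integrable_sq (hy.1 k 0).1).1 (hy.1 k 0)).lintegral_lt_top.ne

end SpectralRep

/-! ### Aliasing -/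

section Aliasing

open scoped ENNReal

/-- The shifted copies `k ↦ F(f - k f_s)`. -/
def shifted {α : Type*} (fs : ℝ) (F : ℝ → α) (f : ℝ) (k : ℤ) : α := F (f - k * fs)

/-- The Nyquist interval is a fundamental domain for translation by multiples of `fs`; the index is
negated to match the sign in `f - k * fs`. -/
lemma lintegral_eq_tsum_shifted {fs : ℝ} (hfs : 0 < fs) (F : ℝ → ℝ≥0∞) :
    ∫⁻ f, F f = ∑' k : ℤ, ∫⁻ f in Set.Ioc (-(fs / 2)) (fs / 2), shifted fs F f k := by
  have hd := isAddFundamentalDomain_Ioc hfs (-(fs / 2))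
  have : VAddInvariantMeasure (AddSubgroup.zmultiples fs) ℝ volume :=
    ⟨fun c s _ => measure_preimage_add _ _ _⟩
  rw [show -(fs / 2) + fs = fs / 2 by ring] at hd
  have hb : Function.Bijective (fun n : ℤ => (⟨n • fs, n, rfl⟩ : AddSubgroup.zmultiples fs)) :=
    (Equiv.ofInjective (fun n : ℤ => n • fs) (zsmul_left_strictMono hfs).injective).bijective
  rw [hd.lintegral_eq_tsum'', ← (Equiv.ofBijective _ hb).tsum_eq, ← (Equiv.neg ℤ).tsum_eq]
  refine tsum_congr fun k => lintegral_congr fun f => ?_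
  change F ((-k : ℤ) • fs + f) = F (f - k * fs)
  congr 1
  rw [zsmul_eq_mul]; push_cast; ring

lemma aemeasurable_shifted {fs : ℝ} {β : Type*} [MeasurableSpace β] {F : ℝ → β}
    (hF : AEMeasurable F) (k : ℤ) (s : Set ℝ) :
    AEMeasurable (fun f => shifted fs F f k) (volume.restrict s) :=
  (hF.comp_quasiMeasurePreserving
    (measurePreserving_sub_right volume ((k : ℝ) * fs)).quasiMeasurePreserving).restrict

lemma ae_mem_Ioo (fs : ℝ) : ∀ᵐ f ∂(volume.restrict (Set.Ioc (-(fs / 2)) (fs / 2))),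
    f ∈ Set.Ioo (-(fs / 2)) (fs / 2) := by
  rw [← restrict_Ioo_eq_restrict_Ioc]
  exact ae_restrict_mem measurableSet_Ioo

variable {M : ℕ} {C : ℝ → Matrix (Fin M) (Fin M) ℂ} {fs : ℝ} {Υ : ℕ}

/-- The interval has to be open: at `f = ± fs / 2` one further alias lands exactly on the band edge,
where `hband` gives nothing. The endpoints are a null set. -/
lemma shifted_eq_zero_of_bandlimited (hfs : 0 < fs)
    (hband : ∀ f : ℝ, ((Υ : ℝ) + 1 / 2) * fs < |f| → C f = 0)
    {f : ℝ} (hf : f ∈ Set.Ioo (-(fs / 2)) (fs / 2)) {k : ℤ}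
    (hk : k ∉ Finset.Icc (-(Υ : ℤ)) Υ) : shifted fs C f k = 0 := by
  refine hband _ ?_
  obtain ⟨h1, h2⟩ := hf
  rw [Finset.mem_Icc, not_and_or, not_le, not_le] at hk
  rw [lt_abs]
  rcases hk with hk | hk
  · have : (k : ℝ) + 1 ≤ -(Υ : ℝ) := by exact_mod_cast hk
    left
    nlinarith
  · have : (Υ : ℝ) + 1 ≤ (k : ℝ) := by exact_mod_cast hk
    right
    nlinarith

variable {Ω : Type*} [MeasurableSpace Ω] {μ : Measure Ω} {x : Fin M → ℝ → Ω → ℝ}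

lemma totalEnergy_eq_lintegral_shifted (hx : IsWSSWithPSD μ x C) (hfs : 0 < fs)
    (hband : ∀ f : ℝ, ((Υ : ℝ) + 1 / 2) * fs < |f| → C f = 0)
    {R : ℝ → Fin M → ℂ} (hR : ∀ m, Measurable fun f => R f m) :
    totalEnergy C R = ∫⁻ f in Set.Ioc (-(fs / 2)) (fs / 2), ENNReal.ofReal
      (∑ k ∈ Finset.Icc (-(Υ : ℤ)) Υ, energy (shifted fs C f k) (shifted fs R f k)) := by
  have hpos : ∀ f k, 0 ≤ energy (shifted fs C f k) (shifted fs R f k) :=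
    fun f k => energy_nonneg (hx.posSemidef _) _
  rw [totalEnergy, lintegral_eq_tsum_shifted hfs, tsum_eq_sum (s := Finset.Icc (-(Υ : ℤ)) Υ)]
  · rw [← lintegral_finsetSum' _ fun k _ =>
      aemeasurable_shifted (hx.aemeasurable_energy hR).ennreal_ofReal k _]
    exact lintegral_congr fun f => (ENNReal.ofReal_sum_of_nonneg fun k _ => hpos f k).symm
  · intro k hk
    rw [lintegral_eq_zero_iff' (aemeasurable_shifted
      (hx.aemeasurable_energy hR).ennreal_ofReal k _)]
    filter_upwards [ae_mem_Ioo fs] with f hf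
    have h0 := shifted_eq_zero_of_bandlimited hfs hband hf hk
    rw [shifted] at h0
    simp [shifted, h0]

/-! ### Least squares across aliases, and the exact fit given by sufficiency. -/

section Fit

variable {K N : ℕ} {Γ : ℝ → Matrix (Fin N) (Fin M) ℂ} {H : ℝ → Matrix (Fin K) (Fin M) ℂ}

/-- Squared error at the frequency `f` (over all aliases) of the approximation of the row
`r` by the combination `h` of the rows of `H`. -/
def aliasError (C : ℝ → Matrix (Fin M) (Fin M) ℂ) (r : ℝ → Fin M → ℂ)
    (H : ℝ → Matrix (Fin K) (Fin M) ℂ) (fs : ℝ) (Υ : ℕ) (f : ℝ) (h : Fin K → ℂ) : ℝ :=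
  fitError (Finset.Icc (-(Υ : ℤ)) Υ) (shifted fs C f) (shifted fs r f) (shifted fs H f) h

/-- Regularized least squares error at the frequency `f`. -/
def aliasMin (C : ℝ → Matrix (Fin M) (Fin M) ℂ) (r : ℝ → Fin M → ℂ)
    (H : ℝ → Matrix (Fin K) (Fin M) ℂ) (fs : ℝ) (Υ : ℕ) (δ f : ℝ) : ℝ :=
  fitMin (Finset.Icc (-(Υ : ℤ)) Υ) (shifted fs C f) (shifted fs r f) (shifted fs H f) δ

/-- Regularized least squares solution at the frequency `f`. -/
def aliasSol (C : ℝ → Matrix (Fin M) (Fin M) ℂ) (r : ℝ → Fin M → ℂ)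
    (H : ℝ → Matrix (Fin K) (Fin M) ℂ) (fs : ℝ) (Υ : ℕ) (δ f : ℝ) : Fin K → ℂ :=
  fitSol (Finset.Icc (-(Υ : ℤ)) Υ) (shifted fs C f) (shifted fs r f) (shifted fs H f) δ

/-- Sufficiency yields an exact pointwise fit. -/
lemma MaintainsSufficiency.exists_aliasError_eq_zero (hC : ∀ f, (C f).PosSemidef)
    (hsuff : MaintainsSufficiency C Γ H fs Υ) {f : ℝ} (hf : f ∈ Set.Icc (-(fs / 2)) (fs / 2))
    (i : Fin N) : ∃ h, aliasError C (fun f => Γ f i) H fs Υ f h = 0 := by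
  -- Column `i` of `Γ̄ᴴ` equals `H̄ᴴ v`. Taking adjoints, the row `star v` satisfies `(Γ i - star v
  -- * H) C^{1/2} = 0` at every alias, hence leaves no energy.
  obtain ⟨v, hv⟩ := hsuff f hf ⟨Pi.single i 1, rfl⟩
  refine ⟨star v, ?_⟩
  rw [aliasError, fitError]
  refine Finset.sum_eq_zero fun k hk => ?_
  refine energy_mul_self_eq_zero (L := CFC.sqrt (shifted fs C f k))
    (CFC.sqrt_mul_sqrt_self _ (hC _).nonneg) ?_
  rw [Finset.mem_Icc] at hk
  ext m
  have h1 := congrFun hv (⟨k, hk⟩, m)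
  simp only [Matrix.mulVecLin_apply, Matrix.mulVec_single_one] at h1
  have h2 := congrArg star h1
  rw [Matrix.sub_vecMul, Pi.sub_apply, Pi.zero_apply, sub_eq_zero, Matrix.vecMul_vecMul]
  simp only [Matrix.mulVec, dotProduct, star_sum, Matrix.conjTranspose_apply, stacked,
    Matrix.of_apply, star_mul', star_star, Matrix.col_apply] at h2
  refine h2.symm.trans (Finset.sum_congr rfl fun p _ => ?_)
  rw [mul_comm]
  rfl

/-- Cramer's rule: the adjugate and determinant are polynomial in the entries, and inversion in `ℂ`
is measurable, with value `0` at `0`, so singular matrices need no separate treatment. -/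
lemma aemeasurable_inv_apply {X κ : Type*} [MeasurableSpace X] [Fintype κ] [DecidableEq κ]
    {ν : Measure X} {A : X → Matrix κ κ ℂ} (hA : ∀ i j, AEMeasurable (fun t => A t i j) ν)
    (i j : κ) : AEMeasurable (fun t => (A t)⁻¹ i j) ν := by
  have hA' : AEMeasurable (fun t (i j : κ) => A t i j) ν :=
    aemeasurable_pi_lambda _ fun i => aemeasurable_pi_lambda _ fun j => hA i j
  have hdet : Continuous fun B : κ → κ → ℂ => (Matrix.of B).det := Continuous.matrix_det continuous_id
  have hadj : Continuous fun B : κ → κ → ℂ => (Matrix.of B).adjugate i j :=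
    (continuous_apply_apply i j).comp (Continuous.matrix_adjugate continuous_id)
  simp only [Matrix.inv_def, Ring.inverse_eq_inv', Matrix.smul_apply, smul_eq_mul]
  exact (hdet.measurable.comp_aemeasurable hA').inv.mul (hadj.measurable.comp_aemeasurable hA')

/-! ### Measurability in frequency of the least squares data and solutions. -/

section Measurability

lemma IsWSSWithPSD.aemeasurable_shifted (hx : IsWSSWithPSD μ x C)
    (s : Set ℝ) (k : ℤ) (i j : Fin M) :
    AEMeasurable (fun f => shifted fs C f k i j) (volume.restrict s) :=
  TaskADC.aemeasurable_shifted (F := fun f => C f i j) (hx.integrable i j).aemeasurable k s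

lemma IsWSSWithPSD.aemeasurable_gram (hx : IsWSSWithPSD μ x C)
    (hHm : ∀ k m, Measurable fun f => H f k m) (s : Set ℝ) (p q : Fin K) : AEMeasurable (fun f =>
    gram (Finset.Icc (-(Υ : ℤ)) Υ) (shifted fs C f) (shifted fs H f) p q) (volume.restrict s) := by
  have hH : ∀ k p m, AEMeasurable (fun f => shifted fs H f k p m) (volume.restrict s) :=
    fun k p m => TaskADC.aemeasurable_shifted (F := fun f => H f p m) (hHm p m).aemeasurable k s
  have : ∀ f, gram (Finset.Icc (-(Υ : ℤ)) Υ) (shifted fs C f) (shifted fs H f) p q =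
      ∑ k ∈ Finset.Icc (-(Υ : ℤ)) Υ,
        hform (shifted fs C f k) (shifted fs H f k p) (shifted fs H f k q) := fun f => by
    rw [gram, Matrix.sum_apply]
    refine Finset.sum_congr rfl fun k _ => ?_
    rw [hform_eq_sum, Matrix.mul_apply, Finset.sum_comm]
    simp [Matrix.mul_apply, Finset.sum_mul]
  simp only [this]
  exact Finset.aemeasurable_fun_sum _ fun k _ =>
    aemeasurable_hform (hx.aemeasurable_shifted s k) (hH k p) (hH k q)

lemma IsWSSWithPSD.aemeasurable_inv_gram (hx : IsWSSWithPSD μ x C)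
    (hHm : ∀ k m, Measurable fun f => H f k m) (s : Set ℝ) (δ : ℝ) (p q : Fin K) : AEMeasurable (fun f =>
    (gram (Finset.Icc (-(Υ : ℤ)) Υ) (shifted fs C f) (shifted fs H f) + (δ : ℂ) • 1)⁻¹ p q)
    (volume.restrict s) :=
  aemeasurable_inv_apply (fun p q => (hx.aemeasurable_gram hHm s p q).add aemeasurable_const) p q

lemma IsWSSWithPSD.aemeasurable_crossRow (hx : IsWSSWithPSD μ x C)
    {r : ℝ → Fin M → ℂ} (hr : ∀ m, Measurable fun f => r f m)
    (hHm : ∀ k m, Measurable fun f => H f k m) (s : Set ℝ) (p : Fin K) : AEMeasurable (fun f =>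
    crossRow (Finset.Icc (-(Υ : ℤ)) Υ) (shifted fs C f) (shifted fs r f) (shifted fs H f) p)
    (volume.restrict s) := by
  have hH : ∀ k p m, AEMeasurable (fun f => shifted fs H f k p m) (volume.restrict s) :=
    fun k p m => TaskADC.aemeasurable_shifted (F := fun f => H f p m) (hHm p m).aemeasurable k s
  have hr' : ∀ k m, AEMeasurable (fun f => shifted fs r f k m) (volume.restrict s) :=
    fun k m => TaskADC.aemeasurable_shifted (F := fun f => r f m) (hr m).aemeasurable k s
  have : ∀ f, crossRow (Finset.Icc (-(Υ : ℤ)) Υ) (shifted fs C f) (shifted fs r f)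
      (shifted fs H f) p = ∑ k ∈ Finset.Icc (-(Υ : ℤ)) Υ,
        hform (shifted fs C f k) (shifted fs r f k) (shifted fs H f k p) := fun f => by
    rw [crossRow, Finset.sum_apply]
    refine Finset.sum_congr rfl fun k _ => ?_
    rw [← Matrix.vecMul_vecMul, Matrix.vecMul, hform, Matrix.dotProduct_mulVec]
    rfl
  simp only [this]
  exact Finset.aemeasurable_fun_sum _ fun k _ =>
    aemeasurable_hform (hx.aemeasurable_shifted s k) (hr' k) (hH k p)

lemma IsWSSWithPSD.aemeasurable_aliasSol (hx : IsWSSWithPSD μ x C)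
    {r : ℝ → Fin M → ℂ} (hr : ∀ m, Measurable fun f => r f m)
    (hHm : ∀ k m, Measurable fun f => H f k m) (s : Set ℝ) (δ : ℝ) (p : Fin K) :
    AEMeasurable (fun f => aliasSol C r H fs Υ δ f p) (volume.restrict s) := by
  simp only [aliasSol, fitSol, ridgeSol, Matrix.vecMul, dotProduct]
  exact Finset.aemeasurable_fun_sum _ fun q _ =>
    (hx.aemeasurable_crossRow hr hHm s q).mul (hx.aemeasurable_inv_gram hHm s δ q p)

lemma IsWSSWithPSD.aemeasurable_aliasError (hx : IsWSSWithPSD μ x C)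
    {r : ℝ → Fin M → ℂ} (hr : ∀ m, Measurable fun f => r f m)
    (hHm : ∀ k m, Measurable fun f => H f k m) (s : Set ℝ) {h : ℝ → Fin K → ℂ}
    (hh : ∀ p, AEMeasurable (fun f => h f p) (volume.restrict s)) :
    AEMeasurable (fun f => aliasError C r H fs Υ f (h f)) (volume.restrict s) := by
  have hH : ∀ k p m, AEMeasurable (fun f => shifted fs H f k p m) (volume.restrict s) :=
    fun k p m => TaskADC.aemeasurable_shifted (F := fun f => H f p m) (hHm p m).aemeasurable k s
  have hr' : ∀ k m, AEMeasurable (fun f => shifted fs r f k m) (volume.restrict s) :=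
    fun k m => TaskADC.aemeasurable_shifted (F := fun f => r f m) (hr m).aemeasurable k s
  have hd : ∀ k m, AEMeasurable (fun f => (shifted fs r f k - h f ᵥ* shifted fs H f k) m)
      (volume.restrict s) := fun k m => (hr' k m).sub
    (Finset.aemeasurable_fun_sum Finset.univ fun p _ => (hh p).mul (hH k p m))
  simp only [aliasError, fitError]
  exact Finset.aemeasurable_fun_sum _ fun k _ =>
    TaskADC.aemeasurable_energy (hx.aemeasurable_shifted s k) (hd k)

lemma IsWSSWithPSD.aemeasurable_aliasMin (hx : IsWSSWithPSD μ x C)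
    {r : ℝ → Fin M → ℂ} (hr : ∀ m, Measurable fun f => r f m)
    (hHm : ∀ k m, Measurable fun f => H f k m) (s : Set ℝ) (δ : ℝ) :
    AEMeasurable (fun f => aliasMin C r H fs Υ δ f) (volume.restrict s) :=
  (hx.aemeasurable_aliasError hr hHm s (h := 0) fun _ => aemeasurable_const).sub
    (Complex.measurable_re.comp_aemeasurable (aemeasurable_hform
      (hx.aemeasurable_inv_gram hHm s δ) (hx.aemeasurable_crossRow hr hHm s)
      (hx.aemeasurable_crossRow hr hHm s)))

end Measurability

end Fit

end Aliasing

/-! ### The closed form of the minimum achievable MSE -/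

section ClosedForm

open scoped ENNReal

variable {Ω : Type*} [MeasurableSpace Ω] {μ : Measure Ω} {M N K : ℕ}
  {x : Fin M → ℝ → Ω → ℝ} {C : ℝ → Matrix (Fin M) (Fin M) ℂ} {fs : ℝ} {Υ : ℕ}
  {Γ : ℝ → Matrix (Fin N) (Fin M) ℂ} {H : ℝ → Matrix (Fin K) (Fin M) ℂ} {r : ℝ → Fin M → ℂ}

/-- Periodicity of `g` is what couples the aliases: after folding, the same row `g f` serves all of
them. -/
lemma totalEnergy_sub_vecMul (hx : IsWSSWithPSD μ x C) (hfs : 0 < fs)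
    (hband : ∀ f : ℝ, ((Υ : ℝ) + 1 / 2) * fs < |f| → C f = 0)
    (hr : ∀ m, Measurable fun f => r f m) (hHm : ∀ k m, Measurable fun f => H f k m)
    {g : ℝ → Fin K → ℂ} (hg : ∀ p, Measurable fun f => g f p)
    (hper : ∀ f (k : ℤ), g (f - k * fs) = g f) :
    totalEnergy C (fun f => r f - g f ᵥ* H f) =
      ∫⁻ f in Set.Ioc (-(fs / 2)) (fs / 2), ENNReal.ofReal (aliasError C r H fs Υ f (g f)) := by
  rw [totalEnergy_eq_lintegral_shifted hx hfs hband]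
  · simp only [aliasError, fitError, shifted, hper]
  · exact fun m => (hr m).sub
      (Finset.measurable_fun_sum Finset.univ fun p _ => (hg p).mul (hHm p m))

lemma totalEnergy_eq_lintegral_aliasError_zero (hx : IsWSSWithPSD μ x C) (hfs : 0 < fs)
    (hband : ∀ f : ℝ, ((Υ : ℝ) + 1 / 2) * fs < |f| → C f = 0)
    (hr : ∀ m, Measurable fun f => r f m) (H : ℝ → Matrix (Fin K) (Fin M) ℂ) :
    totalEnergy C r =
      ∫⁻ f in Set.Ioc (-(fs / 2)) (fs / 2), ENNReal.ofReal (aliasError C r H fs Υ f 0) := by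
  rw [totalEnergy_eq_lintegral_shifted hx hfs hband hr]
  simp only [aliasError, fitError, Matrix.zero_vecMul, sub_zero]

lemma aliasError_nonneg (hC : ∀ f, (C f).PosSemidef) (f : ℝ) (h : Fin K → ℂ) :
    0 ≤ aliasError C r H fs Υ f h := fitError_nonneg (fun _ => hC _) h

lemma aliasMin_nonneg (hC : ∀ f, (C f).PosSemidef) {δ : ℝ} (hδ : 0 < δ) (f : ℝ) :
    0 ≤ aliasMin C r H fs Υ δ f := fitMin_nonneg (fun _ => hC _) hδ

lemma aliasMin_le (hC : ∀ f, (C f).PosSemidef) {δ : ℝ} (hδ : 0 < δ) (f : ℝ) :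
    aliasMin C r H fs Υ δ f ≤ aliasError C r H fs Υ f 0 :=
  fitMin_le_fitError_zero (fun _ => hC _) hδ

/-- The error of the zero filter is the whole folded energy of `r`. It dominates in both limit
arguments, for the closed form and for the digital filters. -/
lemma integrableOn_aliasError_zero (hx : IsWSSWithPSD μ x C) (hfs : 0 < fs)
    (hband : ∀ f : ℝ, ((Υ : ℝ) + 1 / 2) * fs < |f| → C f = 0)
    (hr : ∀ m, Measurable fun f => r f m) (hHm : ∀ k m, Measurable fun f => H f k m)
    (hfin : totalEnergy C r ≠ ∞) :
    IntegrableOn (fun f => aliasError C r H fs Υ f 0) (Set.Ioc (-(fs / 2)) (fs / 2)) := by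
  refine (lintegral_ofReal_ne_top_iff_integrable
    (hx.aemeasurable_aliasError hr hHm _ (h := 0) fun _ => aemeasurable_const).aestronglyMeasurable
    (Eventually.of_forall fun f => aliasError_nonneg hx.posSemidef f 0)).1 ?_
  have := totalEnergy_eq_lintegral_aliasError_zero hx hfs hband hr H
  rwa [this] at hfin

lemma integrableOn_aliasMin (hx : IsWSSWithPSD μ x C) (hfs : 0 < fs)
    (hband : ∀ f : ℝ, ((Υ : ℝ) + 1 / 2) * fs < |f| → C f = 0)
    (hr : ∀ m, Measurable fun f => r f m) (hHm : ∀ k m, Measurable fun f => H f k m)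
    (hfin : totalEnergy C r ≠ ∞) {δ : ℝ} (hδ : 0 < δ) :
    IntegrableOn (fun f => aliasMin C r H fs Υ δ f) (Set.Ioc (-(fs / 2)) (fs / 2)) := by
  refine (integrableOn_aliasError_zero hx hfs hband hr hHm hfin (Υ := Υ)).mono'
    (hx.aemeasurable_aliasMin hr hHm _ δ).aestronglyMeasurable (Eventually.of_forall fun f => ?_)
  rw [Real.norm_of_nonneg (aliasMin_nonneg hx.posSemidef hδ f)]
  exact aliasMin_le hx.posSemidef hδ f

/-- Dominated convergence: pointwise decay comes from the exact fit, which may depend arbitrarily on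
`f`, and the bound from the zero filter. -/
lemma tendsto_integral_aliasMin (hx : IsWSSWithPSD μ x C) (hfs : 0 < fs)
    (hband : ∀ f : ℝ, ((Υ : ℝ) + 1 / 2) * fs < |f| → C f = 0)
    (hΓm : ∀ i m, Measurable fun f => Γ f i m) (hHm : ∀ k m, Measurable fun f => H f k m)
    (hsuff : MaintainsSufficiency C Γ H fs Υ) (i : Fin N)
    (hfin : totalEnergy C (fun f => Γ f i) ≠ ∞) {δ : ℕ → ℝ} (hδ : ∀ᶠ n in atTop, 0 < δ n)
    (hlim : Tendsto δ atTop (𝓝 0)) :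
    Tendsto (fun n => ∫ f in Set.Ioc (-(fs / 2)) (fs / 2),
      aliasMin C (fun f => Γ f i) H fs Υ (δ n) f) atTop (𝓝 0) := by
  have h := tendsto_integral_filter_of_dominated_convergence
    (μ := volume.restrict (Set.Ioc (-(fs / 2)) (fs / 2)))
    (F := fun n f => aliasMin C (fun f => Γ f i) H fs Υ (δ n) f) (f := fun _ => (0 : ℝ)) (l := atTop)
    (fun f => aliasError C (fun f => Γ f i) H fs Υ f 0)
    (Eventually.of_forall fun n =>
      (hx.aemeasurable_aliasMin (hΓm i) hHm _ (δ n)).aestronglyMeasurable)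
    (by
      filter_upwards [hδ] with n hn
      refine Eventually.of_forall fun f => ?_
      rw [Real.norm_of_nonneg (aliasMin_nonneg hx.posSemidef hn f)]
      exact aliasMin_le hx.posSemidef hn f)
    (integrableOn_aliasError_zero hx hfs hband (hΓm i) hHm hfin)
    (by
      refine (ae_restrict_mem measurableSet_Ioc).mono fun f hf => ?_
      obtain ⟨h, hh⟩ := hsuff.exists_aliasError_eq_zero hx.posSemidef ⟨hf.1.le, hf.2⟩ i
      exact tendsto_fitMin (fun _ => hx.posSemidef _) hh hδ hlim)
  simpa using h

/-- On the open Nyquist interval the aliased series are finite sums. -/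
lemma aliasedCross_eq_sum (hfs : 0 < fs)
    (hband : ∀ f : ℝ, ((Υ : ℝ) + 1 / 2) * fs < |f| → C f = 0)
    {f : ℝ} (hf : f ∈ Set.Ioo (-(fs / 2)) (fs / 2)) (Γ : ℝ → Matrix (Fin N) (Fin M) ℂ)
    (H : ℝ → Matrix (Fin K) (Fin M) ℂ) : aliasedCross C Γ H fs f =
      ∑ k ∈ Finset.Icc (-(Υ : ℤ)) Υ, shifted fs Γ f k * shifted fs C f k * (shifted fs H f k)ᴴ := by
  rw [aliasedCross]
  refine tsum_eq_sum fun k hk => ?_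
  have := shifted_eq_zero_of_bandlimited hfs hband hf hk
  rw [shifted] at this
  simp [this]

/-- Pulling `1 / fs` out of `quantizedPSD` leaves the Gram matrix plus the ridge `fs Δ²/4`. Row by
row the trace is then the error reduction achieved by the ridge solution; the remaining factor `fs`
cancels `T_s` in the closed form. -/
lemma trace_integrand (hC : ∀ f, (C f).PosSemidef) (hfs : 0 < fs)
    (hband : ∀ f : ℝ, ((Υ : ℝ) + 1 / 2) * fs < |f| → C f = 0)
    {f : ℝ} (hf : f ∈ Set.Ioo (-(fs / 2)) (fs / 2)) {Δ : ℝ} (hΔ : 0 < Δ) :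
    (aliasedCross C Γ H fs f * (quantizedPSD C H fs Δ f)⁻¹ * (aliasedCross C Γ H fs f)ᴴ).trace =
      ((fs * ∑ i, (aliasError C (fun f => Γ f i) H fs Υ f 0 -
        aliasMin C (fun f => Γ f i) H fs Υ (fs * Δ ^ 2 / 4) f) : ℝ) : ℂ) := by
  have hδ : 0 < fs * Δ ^ 2 / 4 := by positivity
  have hP := posDef_add_smul_one (gram_posSemidef (s := Finset.Icc (-(Υ : ℤ)) Υ)
    (C := shifted fs C f) (B := shifted fs H f) fun _ => hC _) hδ
  set P := gram (Finset.Icc (-(Υ : ℤ)) Υ) (shifted fs C f) (shifted fs H f) with hPdef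
  have hfs' : (fs : ℂ) ≠ 0 := by exact_mod_cast hfs.ne'
  have hq : quantizedPSD C H fs Δ f =
      ((fs : ℂ)⁻¹) • (P + ((fs * Δ ^ 2 / 4 : ℝ) : ℂ) • (1 : Matrix (Fin K) (Fin K) ℂ)) := by
    rw [quantizedPSD, aliasedCross_eq_sum hfs hband hf, ← gram, ← hPdef, smul_add, smul_smul]
    congr 2
    · push_cast; simp
    · push_cast; field_simp
  have hu : IsUnit (P + ((fs * Δ ^ 2 / 4 : ℝ) : ℂ) • (1 : Matrix (Fin K) (Fin K) ℂ)).det :=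
    (Matrix.isUnit_iff_isUnit_det _).1 hP.isUnit
  have hinv : (quantizedPSD C H fs Δ f)⁻¹ =
      (fs : ℂ) • (P + ((fs * Δ ^ 2 / 4 : ℝ) : ℂ) • (1 : Matrix (Fin K) (Fin K) ℂ))⁻¹ := by
    rw [hq]
    refine Matrix.inv_eq_left_inv ?_
    rw [smul_mul_smul_comm, mul_inv_cancel₀ hfs', Matrix.nonsing_inv_mul _ hu, one_smul]
  have hrow : ∀ i, aliasedCross C Γ H fs f i = crossRow (Finset.Icc (-(Υ : ℤ)) Υ)
      (shifted fs C f) (shifted fs (fun f => Γ f i) f) (shifted fs H f) := fun i => by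
    rw [aliasedCross_eq_sum hfs hband hf, crossRow]
    ext p
    rw [Matrix.sum_apply, Finset.sum_apply]
    refine Finset.sum_congr rfl fun k _ => ?_
    rw [Matrix.mul_assoc, Matrix.mul_apply]
    rfl
  rw [hinv, Matrix.mul_smul, Matrix.smul_mul, Matrix.trace_smul, energy_eq_trace, smul_eq_mul,
    Complex.ofReal_mul, Complex.ofReal_sum]
  congr 1
  refine Finset.sum_congr rfl fun i _ => ?_
  rw [hrow, hform_self hP.inv.1]
  simp only [aliasError, aliasMin, fitMin, ridgeMin, sub_sub_cancel]
  rfl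

/-- The closed form is the integral of the regularized least squares errors. -/
lemma closedFormMSE_eq (hx : IsWSSWithPSD μ x C) (hfs : 0 < fs)
    (hband : ∀ f : ℝ, ((Υ : ℝ) + 1 / 2) * fs < |f| → C f = 0)
    (hΓm : ∀ i m, Measurable fun f => Γ f i m) (hHm : ∀ k m, Measurable fun f => H f k m)
    {u : Fin N → Ω → ℝ} (hfin : ∀ i, totalEnergy C (fun f => Γ f i) ≠ ∞)
    (hu : ∀ i, ∫ ω, u i ω ^ 2 ∂μ = (totalEnergy C (fun f => Γ f i)).toReal)
    {Δ : ℝ} (hΔ : 0 < Δ) :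
    closedFormMSE μ u C Γ H fs Δ = ∑ i, ∫ f in Set.Ioc (-(fs / 2)) (fs / 2),
      aliasMin C (fun f => Γ f i) H fs Υ (fs * Δ ^ 2 / 4) f := by
  have hδ : 0 < fs * Δ ^ 2 / 4 := by positivity
  have hA : ∀ i, IntegrableOn (fun f => aliasError C (fun f => Γ f i) H fs Υ f 0)
      (Set.Ioc (-(fs / 2)) (fs / 2)) := fun i =>
    integrableOn_aliasError_zero hx hfs hband (hΓm i) hHm (hfin i)
  have hB : ∀ i, IntegrableOn
      (fun f => aliasMin C (fun f => Γ f i) H fs Υ (fs * Δ ^ 2 / 4) f)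
      (Set.Ioc (-(fs / 2)) (fs / 2)) := fun i =>
    integrableOn_aliasMin hx hfs hband (hΓm i) hHm (hfin i) hδ
  have hAB : ∀ i, IntegrableOn (fun f => aliasError C (fun f => Γ f i) H fs Υ f 0 -
      aliasMin C (fun f => Γ f i) H fs Υ (fs * Δ ^ 2 / 4) f) (Set.Ioc (-(fs / 2)) (fs / 2)) :=
    fun i => (hA i).sub (hB i)
  have hE : ∀ i, ∫ ω, u i ω ^ 2 ∂μ = ∫ f in Set.Ioc (-(fs / 2)) (fs / 2),
      aliasError C (fun f => Γ f i) H fs Υ f 0 := fun i => by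
    rw [hu, totalEnergy_eq_lintegral_aliasError_zero hx hfs hband (hΓm i) H,
      integral_eq_lintegral_of_nonneg_ae
        (Eventually.of_forall fun f => aliasError_nonneg hx.posSemidef f 0) (hA i).1]
  have hT : ∫ f in (-(fs / 2))..(fs / 2),
      (aliasedCross C Γ H fs f * (quantizedPSD C H fs Δ f)⁻¹ *
        (aliasedCross C Γ H fs f)ᴴ).trace =
      ((fs * ∑ i, ((∫ f in Set.Ioc (-(fs / 2)) (fs / 2),
          aliasError C (fun f => Γ f i) H fs Υ f 0) -
        ∫ f in Set.Ioc (-(fs / 2)) (fs / 2),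
          aliasMin C (fun f => Γ f i) H fs Υ (fs * Δ ^ 2 / 4) f) : ℝ) : ℂ) := by
    rw [intervalIntegral.integral_of_le (by linarith), integral_congr_ae
      ((ae_mem_Ioo fs).mono fun f hf => trace_integrand hx.posSemidef hfs hband hf hΔ),
      integral_complex_ofReal, integral_const_mul,
      integral_finsetSum _ fun i _ => hAB i]
    rw [Finset.sum_congr rfl fun i _ => integral_sub (hA i) (hB i)]
  rw [closedFormMSE, hT, ← Complex.ofReal_mul, Complex.ofReal_re, ← mul_assoc,
    one_div_mul_cancel hfs.ne', one_mul, Finset.sum_sub_distrib, Finset.sum_congr rfl fun i _ => hE i,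
    sub_sub_cancel]

end ClosedForm

/-! ### Approximation by trigonometric polynomials -/

section Trigonometric

open scoped ENNReal

/-- Trigonometric polynomials are dense in `L²(ν)` for every finite measure on the circle. -/
lemma exists_trigPolynomial_lintegral_le {T : ℝ} [Fact (0 < T)] (ν : Measure (AddCircle T))
    [IsFiniteMeasure ν] {G : AddCircle T → ℂ} (hG : Measurable G) {B : ℝ} (hB : ∀ θ, ‖G θ‖ ≤ B)
    {ε : ℝ} (hε : 0 < ε) : ∃ c : ℤ →₀ ℂ,
    ∫⁻ θ, ‖G θ - ∑ n ∈ c.support, c n * fourier n θ‖ₑ ^ 2 ∂ν ≤ ENNReal.ofReal ε := by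
  -- Two errors of size `η`, one in `L²(ν)` and one uniform, add up to at most `2 η² + 2 η² ν(univ)
  -- = η² D`, so `η² = ε / D`.
  set D : ℝ := 2 + 2 * ν.real Set.univ with hD
  have hDpos : 0 < D := by positivity
  set η : ℝ := √(ε / D) with hη
  have hηpos : 0 < η := Real.sqrt_pos.2 (by positivity)
  have hηsq : η ^ 2 = ε / D := Real.sq_sqrt (by positivity)
  have hGm : MemLp G 2 ν := MemLp.of_bound hG.aestronglyMeasurable B (Eventually.of_forall hB)
  obtain ⟨φ, hφ, -⟩ := hGm.exists_boundedContinuous_eLpNorm_sub_le (by simp)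
    (ε := ENNReal.ofReal η) (by simpa using hηpos)
  have hmem : φ.toContinuousMap ∈ (Submodule.span ℂ (Set.range (@fourier T))).topologicalClosure := by
    rw [span_fourier_closure_eq_top]; trivial
  obtain ⟨p, hp, hdist⟩ := Metric.mem_closure_iff.1 hmem η hηpos
  obtain ⟨c, rfl⟩ := Finsupp.mem_span_range_iff_exists_finsupp.1 hp
  refine ⟨c, ?_⟩
  have hsum : ∀ θ, (c.sum fun n z => z • @fourier T n) θ = ∑ n ∈ c.support, c n * fourier n θ :=
    fun θ => by simp [Finsupp.sum, ContinuousMap.sum_apply]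
  have h1 : ∫⁻ θ, ‖G θ - φ θ‖ₑ ^ 2 ∂ν ≤ ENNReal.ofReal (η ^ 2) := by
    have h := ENNReal.rpow_le_rpow hφ (z := 2) (by norm_num)
    rw [eLpNorm_eq_lintegral_rpow_enorm_toReal (by simp) (by simp), ← ENNReal.rpow_mul] at h
    simpa [ENNReal.ofReal_pow hηpos.le] using h
  have h2 : ∀ θ, ‖φ θ - ∑ n ∈ c.support, c n * fourier n θ‖ₑ ^ 2 ≤ ENNReal.ofReal (η ^ 2) := by
    intro θ
    rw [enorm_sq_eq_ofReal]
    refine ENNReal.ofReal_le_ofReal ?_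
    have := ContinuousMap.dist_apply_le_dist (f := φ.toContinuousMap)
      (g := c.sum fun n z => z • @fourier T n) θ
    rw [hsum, dist_eq_norm] at this
    have h3 := this.trans hdist.le
    gcongr
    exact h3
  have hle := secondMoment_add_le (μ := ν) one_pos (u := fun θ => G θ - φ θ)
    (hG.sub φ.continuous.measurable).aemeasurable
    (fun θ => φ θ - ∑ n ∈ c.support, c n * fourier n θ)
  simp only [secondMoment, Pi.add_apply, sub_add_sub_cancel] at hle
  refine hle.trans ?_
  calc _ ≤ ENNReal.ofReal (1 + 1) * ENNReal.ofReal (η ^ 2) +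
        ENNReal.ofReal (1 + 1⁻¹) * ∫⁻ _, ENNReal.ofReal (η ^ 2) ∂ν := by
        gcongr with θ
        exact h2 θ
    _ = ENNReal.ofReal (1 + 1) * ENNReal.ofReal (η ^ 2) + ENNReal.ofReal (1 + 1⁻¹) *
        (ENNReal.ofReal (η ^ 2) * ENNReal.ofReal (ν.real Set.univ)) := by
        rw [lintegral_const, ofReal_measureReal]
    _ = ENNReal.ofReal ε := by
        rw [← ENNReal.ofReal_mul (by positivity), ← ENNReal.ofReal_mul (by positivity),
          ← ENNReal.ofReal_mul (by positivity), ← ENNReal.ofReal_add (by positivity)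
          (by positivity), hηsq]
        congr 1
        rw [hD] at hDpos ⊢
        field_simp
        ring

lemma fourier_coe_eq_char {T : ℝ} (n : ℤ) (f : ℝ) :
    fourier n (f : AddCircle T) = char (n * (1 / T)) f := by
  rw [fourier_coe_apply, char]
  congr 1
  push_cast
  ring

variable {Ω : Type*} [MeasurableSpace Ω] {μ : Measure Ω} {M N K : ℕ}
  {x : Fin M → ℝ → Ω → ℝ} {C : ℝ → Matrix (Fin M) (Fin M) ℂ} {fs : ℝ} {Υ : ℕ}
  {Γ : ℝ → Matrix (Fin N) (Fin M) ℂ} {H : ℝ → Matrix (Fin K) (Fin M) ℂ} {r : ℝ → Fin M → ℂ}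

/-- Sufficiency allows approximation by bounded periodic digital filters. -/
lemma exists_periodic_totalEnergy_le [Fact (0 < fs)] (hx : IsWSSWithPSD μ x C)
    (hband : ∀ f : ℝ, ((Υ : ℝ) + 1 / 2) * fs < |f| → C f = 0)
    (hΓm : ∀ i m, Measurable fun f => Γ f i m) (hHm : ∀ k m, Measurable fun f => H f k m)
    (hsuff : MaintainsSufficiency C Γ H fs Υ) (i : Fin N)
    (hfin : totalEnergy C (fun f => Γ f i) ≠ ∞) {ε : ℝ} (hε : 0 < ε) :
    ∃ G : AddCircle fs → Fin K → ℂ, Measurable G ∧ (∃ B : ℝ, ∀ θ p, ‖G θ p‖ ≤ B) ∧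
      totalEnergy C (fun f => Γ f i - G f ᵥ* H f) ≤ ENNReal.ofReal ε := by
  have hfs : 0 < fs := Fact.out
  set I := Set.Ioc (-(fs / 2)) (fs / 2) with hI
  have hC := hx.posSemidef
  let δ : ℕ → ℝ := fun n => 1 / ((n : ℝ) + 1)
  have hδ : ∀ n, 0 < δ n := fun n => by positivity
  let sol : ℕ → ℝ → Fin K → ℂ := fun n f => aliasSol C (fun f => Γ f i) H fs Υ (δ n) f
  have hsol : ∀ n, AEMeasurable (sol n) (volume.restrict I) := fun n =>
    aemeasurable_pi_lambda _ fun p => hx.aemeasurable_aliasSol (hΓm i) hHm I (δ n) p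
  -- The solutions are only almost everywhere measurable in `f`; genuinely measurable versions are
  -- needed to build functions on the circle.
  let S : ℕ → ℝ → Fin K → ℂ := fun n => (hsol n).mk
  have hS : ∀ n, Measurable (S n) := fun n => (hsol n).measurable_mk
  have hSeq : ∀ᵐ f ∂(volume.restrict I), ∀ n, sol n f = S n f :=
    ae_all_iff.2 fun n => (hsol n).ae_eq_mk
  classical
  -- Oversized rows are replaced by zero rather than clipped: the error is then that of a ridge
  -- solution or of the zero filter, and the latter bounds both.
  let g : ℕ → ℝ → Fin K → ℂ := fun n f => if ∀ p, ‖S n f p‖ ≤ (n : ℝ) + 1 then S n f else 0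
  have hg : ∀ n, Measurable (g n) := fun n => by
    refine Measurable.ite ?_ (hS n) measurable_const
    rw [Set.ofPred_forall]
    exact MeasurableSet.iInter fun p =>
      measurableSet_le ((measurable_pi_apply p).comp (hS n)).norm measurable_const
  have hgB : ∀ n f p, ‖g n f p‖ ≤ (n : ℝ) + 1 := fun n f p => by
    simp only [g]
    split_ifs with h
    · exact h p
    · simp only [Pi.zero_apply, norm_zero]; positivity
  -- Transport to the circle makes the filter periodic while keeping its values on the Nyquist
  -- interval.
  let e := AddCircle.measurableEquivIoc fs (-(fs / 2))
  let G : ℕ → AddCircle fs → Fin K → ℂ := fun n θ => g n (e θ).1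
  have hG : ∀ n, Measurable (G n) := fun n => (hg n).comp (measurable_subtype_coe.comp e.measurable)
  have hGg : ∀ n, ∀ f ∈ I, G n (f : AddCircle fs) = g n f := fun n f hf => by
    have hf' : f ∈ Set.Ioc (-(fs / 2)) (-(fs / 2) + fs) := by
      rw [show -(fs / 2) + fs = fs / 2 by ring]; exact hf
    have : e (f : AddCircle fs) = ⟨f, hf'⟩ := e.apply_symm_apply ⟨f, hf'⟩
    simp only [G, this]
  have hper : ∀ n f (k : ℤ), G n ((f - k * fs : ℝ) : AddCircle fs) = G n (f : AddCircle fs) :=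
    fun n f k => by
      congr 1
      rw [← zsmul_eq_mul, AddCircle.coe_sub, AddCircle.coe_zsmul, AddCircle.coe_period, smul_zero,
        sub_zero]
  have hGm : ∀ n p, Measurable fun f : ℝ => G n (f : AddCircle fs) p := fun n p =>
    (measurable_pi_apply p).comp ((hG n).comp AddCircle.measurable_mk')
  have hE : ∀ n, totalEnergy C (fun f => Γ f i - G n (f : AddCircle fs) ᵥ* H f) =
      ∫⁻ f in I, ENNReal.ofReal (aliasError C (fun f => Γ f i) H fs Υ f (g n f)) := fun n => by
    rw [totalEnergy_sub_vecMul hx hfs hband (hΓm i) hHm (hGm n) (hper n)]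
    refine setLIntegral_congr_fun measurableSet_Ioc fun f hf => ?_
    simp only [hGg n f hf]
  have hlim : Tendsto (fun n => ∫⁻ f in I,
      ENNReal.ofReal (aliasError C (fun f => Γ f i) H fs Υ f (g n f))) atTop (𝓝 0) := by
    have hα := integrableOn_aliasError_zero hx hfs hband (hΓm i) hHm hfin (Υ := Υ)
    have h := tendsto_lintegral_of_dominated_convergence' (μ := volume.restrict I)
      (F := fun n f => ENNReal.ofReal (aliasError C (fun f => Γ f i) H fs Υ f (g n f)))
      (f := fun _ => (0 : ℝ≥0∞))
      (fun f => ENNReal.ofReal (aliasError C (fun f => Γ f i) H fs Υ f 0))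
      (fun n => (hx.aemeasurable_aliasError (hΓm i) hHm I fun p =>
        ((measurable_pi_apply p).comp (hg n)).aemeasurable).ennreal_ofReal)
      (fun n => by
        filter_upwards [hSeq] with f hf
        refine ENNReal.ofReal_le_ofReal ?_
        simp only [g]
        split_ifs with h
        · rw [← hf n]
          exact (fitError_sol_le (fun _ => hC _) (hδ n)).trans (aliasMin_le hC (hδ n) f)
        · exact le_rfl)
      hα.lintegral_lt_top.ne
      (by
        filter_upwards [hSeq, ae_restrict_mem measurableSet_Ioc] with f hf hfI
        rw [← ENNReal.ofReal_zero]
        refine (ENNReal.continuous_ofReal.tendsto 0).comp ?_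
        obtain ⟨h, hh⟩ := hsuff.exists_aliasError_eq_zero hC ⟨hfI.1.le, hfI.2⟩ i
        have ht := tendsto_fitMin (fun _ => hC _) hh (Eventually.of_forall hδ)
          tendsto_one_div_add_atTop_nhds_zero_nat
        refine tendsto_of_tendsto_of_tendsto_of_le_of_le' tendsto_const_nhds ht
          (Eventually.of_forall fun n => aliasError_nonneg hC f _) ?_
        -- The squared norm is at most `(n + 1)` times the error of the zero filter, hence at most
        -- `(n + 1)²` once `n` exceeds that error: at each such `f` the truncation is eventually
        -- inactive.
        obtain ⟨n₀, hn₀⟩ := exists_nat_ge (aliasError C (fun f => Γ f i) H fs Υ f 0)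
        filter_upwards [eventually_ge_atTop n₀] with n hn
        have hcond : ∀ p, ‖S n f p‖ ≤ (n : ℝ) + 1 := fun p => by
          have h1 : ‖sol n f p‖ ^ 2 ≤ (δ n)⁻¹ * aliasError C (fun f => Γ f i) H fs Υ f 0 :=
            norm_fitSol_sq_le (fun _ => hC _) (hδ n) p
          rw [← hf n]
          have h2 : (δ n)⁻¹ = (n : ℝ) + 1 := by simp [δ]
          have h3 : (n₀ : ℝ) ≤ n := by exact_mod_cast hn
          rw [h2] at h1
          refine abs_le_of_sq_le_sq' (h1.trans ?_) (by positivity) |>.2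
          rw [sq]
          gcongr
          linarith
        have hgn : g n f = sol n f := by simp only [g, if_pos hcond, hf n]
        rw [hgn]
        exact fitError_sol_le (fun _ => hC _) (hδ n))
    simpa using h
  obtain ⟨n, hn⟩ := (hlim.eventually_le_const (u := ENNReal.ofReal ε) (by simpa using hε)).exists
  exact ⟨G n, hG n, ⟨(n : ℝ) + 1, fun θ p => hgB n _ p⟩, (hE n).trans_le hn⟩

/-- Decouples the channels: each entry of `g` may be approximated separately, in the scalar space
weighted by the output spectrum of its own channel. -/
lemma totalEnergy_vecMul_le (hx : IsWSSWithPSD μ x C) (hHm : ∀ k m, Measurable fun f => H f k m)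
    {g : ℝ → Fin K → ℂ} (hg : ∀ p, Measurable fun f => g f p) :
    totalEnergy C (fun f => g f ᵥ* H f) ≤ ENNReal.ofReal (2 ^ K) *
      ∑ p, ∫⁻ f, ENNReal.ofReal (energy (C f) (H f p)) * ‖g f p‖ₑ ^ 2 := by
  have hm : ∀ p, AEMeasurable fun f => ENNReal.ofReal (energy (C f) (H f p)) * ‖g f p‖ₑ ^ 2 :=
    fun p => (hx.aemeasurable_energy (hHm p)).ennreal_ofReal.mul
      ((hg p).enorm.pow_const 2).aemeasurable
  rw [totalEnergy, ← lintegral_finsetSum' _ fun p _ => hm p,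
    ← lintegral_const_mul' _ _ ENNReal.ofReal_ne_top]
  refine lintegral_mono fun f => ?_
  have h0 : ∀ p, 0 ≤ energy (C f) (H f p) := fun p => energy_nonneg (hx.posSemidef f) _
  have h1 : g f ᵥ* H f = ∑ p, g f p • H f p := Matrix.vecMul_eq_sum _ _
  have h2 := energy_sum_le (hx.posSemidef f) Finset.univ fun p => g f p • H f p
  rw [← h1, Finset.card_univ, Fintype.card_fin] at h2
  refine (ENNReal.ofReal_le_ofReal h2).trans (le_of_eq ?_)
  rw [ENNReal.ofReal_mul (by positivity), ENNReal.ofReal_sum_of_nonneg]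
  · congr 1
    refine Finset.sum_congr rfl fun p _ => ?_
    rw [energy_smul, mul_comm, ENNReal.ofReal_mul (h0 p), enorm_sq_eq_ofReal]
  · intro p _
    rw [energy_smul]
    exact mul_nonneg (by positivity) (h0 p)

/-- Sufficiency allows approximation by digital filters with finitely many taps. -/
lemma exists_trigPolynomial_totalEnergy_le (hfs : 0 < fs) (hx : IsWSSWithPSD μ x C)
    (hband : ∀ f : ℝ, ((Υ : ℝ) + 1 / 2) * fs < |f| → C f = 0)
    (hΓm : ∀ i m, Measurable fun f => Γ f i m) (hHm : ∀ k m, Measurable fun f => H f k m)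
    (hsuff : MaintainsSufficiency C Γ H fs Υ) (i : Fin N)
    (hfin : totalEnergy C (fun f => Γ f i) ≠ ∞) (hfinH : ∀ k, totalEnergy C (fun f => H f k) ≠ ∞)
    {ε : ℝ} (hε : 0 < ε) :
    ∃ c : Fin K → ℤ →₀ ℂ, totalEnergy C (fun f => Γ f i -
      ∑ k, ∑ n ∈ (c k).support, c k n • char (n * (1 / fs)) f • H f k) ≤ ENNReal.ofReal ε := by
  have : Fact (0 < fs) := ⟨hfs⟩
  obtain ⟨G, hG, ⟨B, hB⟩, hGε⟩ := exists_periodic_totalEnergy_le hx hband hΓm hHm hsuff i hfin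
    (show 0 < ε / 4 by positivity)
  -- The total is at most `2 (ε/4) + 2 · 2^K · K ε'`, and `2^K (K + 1) ε' = ε/4`; using `K + 1`
  -- keeps the divisor nonzero for `K = 0`.
  set ε' : ℝ := ε / (4 * 2 ^ K * (K + 1)) with hε'
  have hε'pos : 0 < ε' := by positivity
  have hw : ∀ k, AEMeasurable fun f => ENNReal.ofReal (energy (C f) (H f k)) :=
    fun k => (hx.aemeasurable_energy (hHm k)).ennreal_ofReal
  have key : ∀ k, ∃ c : ℤ →₀ ℂ, ∫⁻ f, ENNReal.ofReal (energy (C f) (H f k)) *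
      ‖G (f : AddCircle fs) k - ∑ n ∈ c.support, c n * char (n * (1 / fs)) f‖ₑ ^ 2 ≤
        ENNReal.ofReal ε' := fun k => by
    -- The spectral measure of channel `k` on the line, folded onto the circle. Since the integrand
    -- is periodic, its weighted integral over the line is an integral against `ν`.
    set ν := (volume.withDensity fun f => ENNReal.ofReal (energy (C f) (H f k))).map
      ((↑) : ℝ → AddCircle fs) with hν
    have : IsFiniteMeasure (volume.withDensity fun f => ENNReal.ofReal (energy (C f) (H f k))) :=
      isFiniteMeasure_withDensity (hfinH k)
    have hGk : Measurable fun θ => G θ k := (measurable_pi_apply k).comp hG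
    obtain ⟨c, hc⟩ := exists_trigPolynomial_lintegral_le ν hGk (fun θ => hB θ k) hε'pos
    refine ⟨c, le_trans (le_of_eq ?_) hc⟩
    have hmeas : Measurable fun θ : AddCircle fs =>
        ‖G θ k - ∑ n ∈ c.support, c n * fourier n θ‖ₑ ^ 2 :=
      ((hGk.sub (Finset.measurable_fun_sum _ fun n _ =>
        ((fourier n).continuous.measurable.const_mul _))).enorm.pow_const 2)
    have hmeas' : Measurable fun f : ℝ =>
        ‖G (f : AddCircle fs) k - ∑ n ∈ c.support, c n * fourier n (f : AddCircle fs)‖ₑ ^ 2 :=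
      hmeas.comp AddCircle.measurable_mk'
    rw [hν, lintegral_map hmeas AddCircle.measurable_mk']
    refine Eq.trans ?_ (lintegral_withDensity_eq_lintegral_mul₀ (hw k) hmeas'.aemeasurable).symm
    simp only [Pi.mul_apply, fourier_coe_eq_char]
  choose c hc using key
  refine ⟨c, ?_⟩
  let p : ℝ → Fin K → ℂ := fun f k => ∑ n ∈ (c k).support, c k n * char (n * (1 / fs)) f
  have hp : ∀ k, Measurable fun f => p f k := fun k =>
    Finset.measurable_fun_sum _ fun n _ => (continuous_char _).measurable.const_mul _
  have hGm : ∀ k, Measurable fun f : ℝ => G (f : AddCircle fs) k := fun k =>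
    (measurable_pi_apply k).comp (hG.comp AddCircle.measurable_mk')
  have hsplit : (fun f => Γ f i - ∑ k, ∑ n ∈ (c k).support,
      c k n • char (n * (1 / fs)) f • H f k) =
      (fun f => Γ f i - G (f : AddCircle fs) ᵥ* H f) +
        fun f : ℝ => (G (f : AddCircle fs) - p f) ᵥ* H f := by
    funext f
    rw [Pi.add_apply, Matrix.sub_vecMul, sub_add_sub_cancel, Matrix.vecMul_eq_sum (p f)]
    congr 1
    refine Finset.sum_congr rfl fun k _ => ?_
    simp only [p, Finset.sum_smul, smul_smul]
  rw [hsplit]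
  refine (hx.totalEnergy_add_le one_pos (fun m => (hΓm i m).sub
    (Finset.measurable_fun_sum Finset.univ fun k _ => (hGm k).mul (hHm k m))) _).trans ?_
  calc _ ≤ ENNReal.ofReal (1 + 1) * ENNReal.ofReal (ε / 4) + ENNReal.ofReal (1 + 1⁻¹) *
        (ENNReal.ofReal (2 ^ K) * ∑ _k : Fin K, ENNReal.ofReal ε') := by
        gcongr
        · exact hGε
        · refine (totalEnergy_vecMul_le hx hHm fun k => (hGm k).sub (hp k)).trans ?_
          gcongr with k
          exact hc k
    _ = ENNReal.ofReal ((1 + 1) * (ε / 4) + (1 + 1⁻¹) * (2 ^ K * (K * ε'))) := by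
        rw [← ENNReal.ofReal_sum_of_nonneg fun _ _ => hε'pos.le, Finset.sum_const,
          Finset.card_univ, Fintype.card_fin, nsmul_eq_mul,
          ← ENNReal.ofReal_mul (by positivity), ← ENNReal.ofReal_mul (by positivity),
          ← ENNReal.ofReal_mul (by positivity), ← ENNReal.ofReal_add (by positivity)
          (by positivity)]
    _ ≤ ENNReal.ofReal ε := by
        refine ENNReal.ofReal_le_ofReal ?_
        have h1 : (K : ℝ) * ε' ≤ (K + 1) * ε' := by gcongr; linarith
        have h2 : 2 ^ K * ((K + 1) * ε') = ε / 4 := by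
          rw [hε']; field_simp
        have h3 : (2 : ℝ) ^ K * (K * ε') ≤ 2 ^ K * ((K + 1) * ε') := by gcongr
        norm_num
        linarith

end Trigonometric

/-! ### Quantization -/

section Quantization

open scoped ENNReal

lemma abs_midRise_sub_le {γ : ℝ} {b : ℕ} (hγ : 0 < γ) {v : ℝ} (hv : |v| < γ) :
    |midRise γ b v - v| ≤ step γ b / 2 := by
  have hs : 0 < step γ b := by unfold step; positivity
  rw [midRise, if_pos hv, abs_le]
  have h1 := Int.floor_le (v / step γ b)
  have h2 := (Int.lt_floor_add_one (v / step γ b)).le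
  rw [le_div_iff₀ hs] at h1
  rw [div_le_iff₀ hs] at h2
  constructor <;> linarith

lemma measurable_midRise (γ : ℝ) (b : ℕ) : Measurable (midRise γ b) := by
  unfold midRise
  refine Measurable.ite (measurableSet_lt (by fun_prop) measurable_const) ?_ ?_
  · exact ((measurable_from_top (f := fun n : ℤ => (n : ℝ))).comp
      (Int.measurable_floor.comp (measurable_id.div_const _))).add_const _ |>.const_mul _
  · have : Measurable fun v : ℝ => ((SignType.sign v : SignType) : ℝ) := by
      have : (fun v : ℝ => ((SignType.sign v : SignType) : ℝ)) =
          fun v => if 0 < v then 1 else if v < 0 then -1 else 0 := by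
        funext v
        rw [sign_apply]
        split_ifs <;> simp
      rw [this]
      exact Measurable.ite measurableSet_Ioi measurable_const
        (Measurable.ite measurableSet_Iio measurable_const measurable_const)
    exact this.mul_const _

variable {Ω : Type*} [MeasurableSpace Ω] {μ : Measure Ω} {M N K : ℕ}
  {x : Fin M → ℝ → Ω → ℝ}

lemma IsDither.ae_abs_le {Δ : ℝ} {w : Fin K → ℤ → Ω → ℝ} (hw : IsDither μ x Δ w)
    (k : Fin K) (n : ℤ) : ∀ᵐ ω ∂μ, |w k n ω| ≤ Δ := by
  have hset : MeasurableSet {v : ℝ | |v| ≤ Δ} := measurableSet_le (by fun_prop) measurable_const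
  have h : ∀ᵐ v ∂(μ.map (w k n)), |v| ≤ Δ := by
    rw [hw.law k n, ae_iff]
    change (volume.withDensity _) {v : ℝ | |v| ≤ Δ}ᶜ = 0
    rw [withDensity_apply _ hset.compl]
    refine (setLIntegral_congr_fun hset.compl fun v hv => ?_).trans (lintegral_zero)
    have hv' : ¬ |v| ≤ Δ := hv
    simp [triangularPDF, hv']
  exact ae_of_ae_map (hw.measurable k n).aemeasurable h

lemma integral_add_sq_le {u v : Ω → ℝ} (hu : MemLp u 2 μ) (hv : MemLp v 2 μ) :
    ∫ ω, (u ω + v ω) ^ 2 ∂μ ≤ 2 * ∫ ω, u ω ^ 2 ∂μ + 2 * ∫ ω, v ω ^ 2 ∂μ := by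
  have hu2 := (memLp_two_iff_integrable_sq hu.1).1 hu
  have hv2 := (memLp_two_iff_integrable_sq hv.1).1 hv
  have huv : Integrable (fun ω => (u ω + v ω) ^ 2) μ :=
    (memLp_two_iff_integrable_sq (hu.add hv).1).1 (hu.add hv)
  rw [← integral_const_mul, ← integral_const_mul, ← integral_add (hu2.const_mul 2) (hv2.const_mul 2)]
  refine integral_mono huv ((hu2.const_mul 2).add (hv2.const_mul 2)) fun ω => ?_
  beta_reduce
  nlinarith [sq_nonneg (u ω - v ω)]

lemma integral_sq_le_of_ae_abs_le [IsProbabilityMeasure μ] {u : Ω → ℝ}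
    (hu : AEStronglyMeasurable u μ) {B : ℝ} (h : ∀ᵐ ω ∂μ, |u ω| ≤ B) : ∫ ω, u ω ^ 2 ∂μ ≤ B ^ 2 := by
  have hL : MemLp u 2 μ := MemLp.of_bound hu B h
  have := integral_mono_ae ((memLp_two_iff_integrable_sq hu).1 hL) (integrable_const (B ^ 2))
    (h.mono fun ω hω => sq_le_sq' (abs_le.1 hω).1 (abs_le.1 hω).2)
  simpa using this

/-- The quantization step tends to zero as the resolution grows. -/
lemma tendsto_step [IsProbabilityMeasure μ] {η : ℝ} {γ : ℕ → ℝ}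
    {y : Fin K → ℤ → Ω → ℝ} (hy : ∀ k n, MemLp (y k n) 2 μ) {w : ℕ → Fin K → ℤ → Ω → ℝ}
    (hw : ∀ᶠ b in atTop, IsDither μ x (step (γ b) b) (w b))
    (hγ : ∀ᶠ b in atTop, IsDynamicRange μ η (fun k n ω => y k n ω + w b k n ω) (γ b)) :
    Tendsto (fun b => step (γ b) b) atTop (𝓝 0) := by
  set σ : ℝ := ∑ k, ∫ ω, y k 0 ω ^ 2 ∂μ with hσ
  have hσ0 : ∀ k ∈ Finset.univ, 0 ≤ ∫ ω, y k 0 ω ^ 2 ∂μ :=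
    fun k _ => integral_nonneg fun ω => sq_nonneg _
  have hσnn : 0 ≤ σ := Finset.sum_nonneg hσ0
  have hpow : Tendsto (fun b : ℕ => (1 / 4 : ℝ) ^ b) atTop (𝓝 0) :=
    tendsto_pow_atTop_nhds_zero_of_lt_one (by norm_num) (by norm_num)
  have hsq : ∀ b, step (γ b) b ^ 2 = 4 * γ b ^ 2 * (1 / 4 : ℝ) ^ b := fun b => by
    rw [step, div_pow, mul_pow, ← pow_mul, mul_comm b 2, pow_mul, one_div, inv_pow]
    norm_num [div_eq_mul_inv]
  -- The range `γ` is defined through the dither, whose size is proportional to `γ`. As `Δ² = 4 γ²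
  -- 4⁻ᵇ`, the dither contributes at most `8 η² 4⁻ᵇ γ²` to the bound on `γ²`; once that is at most
  -- `γ² / 2` it is absorbed, leaving `γ² ≤ 4 η² σ`.
  have hsmall : ∀ᶠ b : ℕ in atTop, 8 * η ^ 2 * (1 / 4 : ℝ) ^ b ≤ 1 / 2 := by
    have h := hpow.const_mul (8 * η ^ 2)
    rw [mul_zero] at h
    exact h.eventually_le_const (by norm_num)
  have hbound : ∀ᶠ b : ℕ in atTop,
      step (γ b) b ^ 2 ≤ 16 * η ^ 2 * σ * (1 / 4 : ℝ) ^ b := by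
    filter_upwards [hw, hγ, hsmall] with b hwb hγb hb
    have hmax : ⨆ k, ∫ ω, (y k 0 ω + w b k 0 ω) ^ 2 ∂μ ≤ 2 * σ + 2 * step (γ b) b ^ 2 := by
      refine Real.iSup_le (fun k => ?_) (by positivity)
      have hwm := (hwb.measurable k 0).aestronglyMeasurable (μ := μ)
      have h1 := integral_add_sq_le (hy k 0) (MemLp.of_bound hwm _ (hwb.ae_abs_le k 0))
      have h2 := integral_sq_le_of_ae_abs_le hwm (hwb.ae_abs_le k 0)
      have h3 := Finset.single_le_sum hσ0 (Finset.mem_univ k)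
      linarith
    have h1 : γ b ^ 2 ≤ η ^ 2 * (2 * σ + 2 * step (γ b) b ^ 2) := by
      rw [hγb.2 0]
      gcongr
    rw [hsq] at h1 ⊢
    have h2 : γ b ^ 2 * (8 * η ^ 2 * (1 / 4 : ℝ) ^ b) ≤ γ b ^ 2 * (1 / 2) := by gcongr
    have h3 : γ b ^ 2 ≤ 4 * (η ^ 2 * σ) := by linarith
    calc 4 * γ b ^ 2 * (1 / 4 : ℝ) ^ b ≤ 4 * (4 * (η ^ 2 * σ)) * (1 / 4 : ℝ) ^ b := by gcongr
      _ = _ := by ring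
  have hlim : Tendsto (fun b => step (γ b) b ^ 2) atTop (𝓝 0) := by
    refine tendsto_of_tendsto_of_tendsto_of_le_of_le' tendsto_const_nhds
      (h := fun b => 16 * η ^ 2 * σ * (1 / 4 : ℝ) ^ b) ?_
      (Eventually.of_forall fun b => sq_nonneg _) hbound
    simpa using hpow.const_mul (16 * η ^ 2 * σ)
  have h := (Real.continuous_sqrt.tendsto 0).comp hlim
  rw [Real.sqrt_zero] at h
  rw [tendsto_zero_iff_abs_tendsto_zero]
  exact h.congr fun b => Real.sqrt_sq_eq_abs _

lemma step_pos {γ : ℝ} (hγ : 0 < γ) (b : ℕ) : 0 < step γ b := by unfold step; positivity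

/-- Without overload the quantized samples differ from the samples by at most `3Δ/2`. -/
lemma ae_abs_midRise_sub_le {γ : ℝ} {b : ℕ} (hγ : 0 < γ) {y w : Fin K → ℤ → Ω → ℝ}
    (hw : IsDither μ x (step γ b) w)
    (hno : NoOverload μ (fun k n ω => y k n ω + w k n ω) γ) (k : Fin K) (n : ℤ) :
    ∀ᵐ ω ∂μ, |midRise γ b (y k n ω + w k n ω) - y k n ω| ≤ 3 / 2 * step γ b := by
  have h : ∀ᵐ ω ∂μ, ¬ γ ≤ |y k n ω + w k n ω| := by
    rw [ae_iff]
    simpa using hno k n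
  filter_upwards [h, hw.ae_abs_le k n] with ω h1 h2
  -- Half a step from rounding, plus at most one full step from the dither.
  have h3 := abs_midRise_sub_le (b := b) hγ (not_le.1 h1)
  rw [abs_le] at h2 h3 ⊢
  constructor <;> linarith

/-! ### Digital recovery -/

lemma achievableMSE_nonneg (u : Fin N → Ω → ℝ) (z : Fin K → ℤ → Ω → ℝ) :
    0 ≤ achievableMSE μ u z := by
  refine Real.sInf_nonneg ?_
  rintro _ ⟨G, v, -, rfl⟩
  exact Finset.sum_nonneg fun i _ => integral_nonneg fun ω => sq_nonneg _

/-- Any digital filter with finitely many taps bounds the achievable MSE. -/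
lemma achievableMSE_le (u : Fin N → Ω → ℝ) {z : Fin K → ℤ → Ω → ℝ} (hz : ∀ k n, MemLp (z k n) 2 μ)
    (G : ℤ → Matrix (Fin N) (Fin K) ℝ) (F : Finset ℤ) (hG : ∀ n ∉ F, G (-n) = 0) :
    achievableMSE μ u z ≤
      ∑ i, ∫ ω, (u i ω - ∑ n ∈ F, ∑ k, G (-n) i k * z k n ω) ^ 2 ∂μ := by
  refine csInf_le ⟨0, ?_⟩ ⟨G, fun i ω => ∑ n ∈ F, ∑ k, G (-n) i k * z k n ω, fun i => ⟨?_, ?_⟩, rfl⟩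
  · rintro _ ⟨G, v, -, rfl⟩
    exact Finset.sum_nonneg fun i _ => integral_nonneg fun ω => sq_nonneg _
  · exact memLp_finsetSum _ fun n _ => memLp_finsetSum _ fun k _ => (hz k n).const_mul _
  · refine tendsto_const_nhds.congr' ?_
    filter_upwards [eventually_ge_atTop F] with F' hF'
    have : ∀ ω, ∑ n ∈ F, ∑ k, G (-n) i k * z k n ω = ∑ n ∈ F', ∑ k, G (-n) i k * z k n ω :=
      fun ω => Finset.sum_subset hF' fun n _ hn => by simp [hG n hn]
    simp [this]

/-- Small perturbations of the samples perturb the MSE of a fixed digital filter little. -/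
lemma integral_sub_filter_sq_le [IsProbabilityMeasure μ] {u : Ω → ℝ} (hu : MemLp u 2 μ)
    {y z : Fin K → ℤ → Ω → ℝ} (hy : ∀ k n, MemLp (y k n) 2 μ)
    (hz : ∀ k n, AEStronglyMeasurable (z k n) μ) {D : ℝ}
    (hyz : ∀ k n, ∀ᵐ ω ∂μ, |z k n ω - y k n ω| ≤ D)
    (F : Finset ℤ) (a : ℤ → Fin K → ℝ) :
    ∫ ω, (u ω - ∑ n ∈ F, ∑ k, a n k * z k n ω) ^ 2 ∂μ ≤
      2 * ∫ ω, (u ω - ∑ n ∈ F, ∑ k, a n k * y k n ω) ^ 2 ∂μ +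
        2 * ((∑ n ∈ F, ∑ k, |a n k|) * D) ^ 2 := by
  have hd : ∀ᵐ ω ∂μ, |∑ n ∈ F, ∑ k, a n k * y k n ω - ∑ n ∈ F, ∑ k, a n k * z k n ω| ≤
      (∑ n ∈ F, ∑ k, |a n k|) * D := by
    filter_upwards [ae_all_iff.2 fun k => ae_all_iff.2 fun n => hyz k n] with ω hω
    rw [← Finset.sum_sub_distrib, Finset.sum_mul]
    refine (Finset.abs_sum_le_sum_abs _ _).trans (Finset.sum_le_sum fun n _ => ?_)
    rw [← Finset.sum_sub_distrib, Finset.sum_mul]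
    refine (Finset.abs_sum_le_sum_abs _ _).trans (Finset.sum_le_sum fun k _ => ?_)
    rw [← mul_sub, abs_mul, abs_sub_comm]
    exact mul_le_mul_of_nonneg_left (hω k n) (abs_nonneg _)
  have hyL : MemLp (fun ω => ∑ n ∈ F, ∑ k, a n k * y k n ω) 2 μ :=
    memLp_finsetSum _ fun n _ => memLp_finsetSum _ fun k _ => (hy k n).const_mul _
  have hzm : AEStronglyMeasurable (fun ω => ∑ n ∈ F, ∑ k, a n k * z k n ω) μ :=
    Finset.aestronglyMeasurable_fun_sum _ fun n _ =>
      Finset.aestronglyMeasurable_fun_sum _ fun k _ => (hz k n).const_mul _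
  have h1 := integral_add_sq_le (hu.sub hyL) (MemLp.of_bound (hyL.1.sub hzm) _ hd)
  have h2 := integral_sq_le_of_ae_abs_le (hyL.1.sub hzm) hd
  simp only [Pi.sub_apply, sub_add_sub_cancel] at h1 h2
  linarith

end Quantization

/-! ### Recovery by finitely many taps, and its stability under quantization. -/

section Recovery

open scoped ENNReal

variable {Ω : Type*} [MeasurableSpace Ω] {μ : Measure Ω} {M N K : ℕ}
  {x : Fin M → ℝ → Ω → ℝ} {C : ℝ → Matrix (Fin M) (Fin M) ℂ} {fs : ℝ} {Υ : ℕ}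
  {Γ : ℝ → Matrix (Fin N) (Fin M) ℂ} {H : ℝ → Matrix (Fin K) (Fin M) ℂ}
  {v : Fin N → ℝ → Ω → ℝ} {y : Fin K → ℝ → Ω → ℝ}

lemma IsFilterOutput.isSpectralRep_zero (hx : IsWSSWithPSD μ x C)
    (hΓm : ∀ i m, Measurable fun f => Γ f i m) (hv : IsFilterOutput μ x C Γ v) (i : Fin N) :
    IsSpectralRep μ x C (fun ω => (v i 0 ω : ℂ)) (fun f => Γ f i) := by
  have h := hv.isSpectralRep hx hΓm i 0
  have h0 : (fun f => char 0 f • Γ f i) = fun f => Γ f i := by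
    funext f; simp [char]
  rwa [h0] at h

lemma IsFilterOutput.integral_sq (hx : IsWSSWithPSD μ x C)
    (hΓm : ∀ i m, Measurable fun f => Γ f i m) (hv : IsFilterOutput μ x C Γ v) (i : Fin N) :
    ∫ ω, v i 0 ω ^ 2 ∂μ = (totalEnergy C (fun f => Γ f i)).toReal := by
  rw [← (hv.isSpectralRep_zero hx hΓm i).secondMoment_eq hx, secondMoment,
    integral_eq_lintegral_of_nonneg_ae (Eventually.of_forall fun ω => sq_nonneg _)
      (((hv.1 i 0).1.pow 2))]
  simp only [enorm_sq_eq_ofReal, Complex.norm_real, Real.norm_eq_abs, sq_abs]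

lemma memLp_sample (hy : ∀ k t, MemLp (y k t) 2 μ) (k : Fin K) (n : ℤ) :
    MemLp (sample fs y k n) 2 μ := (hy k _).const_mul _

/-- One component of the task is recovered from the samples by finitely many real taps. -/
lemma exists_taps_integral_sq_le (hfs : 0 < fs) (hx : IsWSSWithPSD μ x C)
    (hband : ∀ f : ℝ, ((Υ : ℝ) + 1 / 2) * fs < |f| → C f = 0)
    (hΓm : ∀ i m, Measurable fun f => Γ f i m) (hHm : ∀ k m, Measurable fun f => H f k m)
    (hsuff : MaintainsSufficiency C Γ H fs Υ) (hv : IsFilterOutput μ x C Γ v)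
    (hy : IsFilterOutput μ x C H y) (i : Fin N) {ε : ℝ} (hε : 0 < ε) :
    ∃ a : Fin K → ℤ →₀ ℝ, ∫ ω, (v i 0 ω -
      ∑ k, ∑ n ∈ (a k).support, a k n * sample fs y k n ω) ^ 2 ∂μ ≤ ε := by
  obtain ⟨c, hc⟩ := exists_trigPolynomial_totalEnergy_le hfs hx hband hΓm hHm hsuff i
    (hv.totalEnergy_ne_top hx hΓm i) (fun k => hy.totalEnergy_ne_top hx hHm k) hε
  have hrep : IsSpectralRep μ x C
      ((fun ω => (v i 0 ω : ℂ)) - ∑ k, (1 : ℂ) • ∑ n ∈ (c k).support,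
        c k n • fun ω => (y k (n * (1 / fs)) ω : ℂ))
      ((fun f => Γ f i) - ∑ k, (1 : ℂ) • ∑ n ∈ (c k).support,
        c k n • fun f => char (n * (1 / fs)) f • H f k) :=
    (hv.isSpectralRep_zero hx hΓm i).sub hx (IsSpectralRep.sum_smul hx _ _ fun k _ =>
      IsSpectralRep.sum_smul hx _ _ fun n _ => hy.isSpectralRep hx hHm k _)
  have hresp : ((fun f => Γ f i) - ∑ k, (1 : ℂ) • ∑ n ∈ (c k).support,
        c k n • fun f => char (n * (1 / fs)) f • H f k) = fun f => Γ f i -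
      ∑ k, ∑ n ∈ (c k).support, c k n • char (n * (1 / fs)) f • H f k := by
    funext f
    simp only [one_smul, Pi.sub_apply, Finset.sum_apply, Pi.smul_apply]
  have hmom := hrep.secondMoment_eq hx
  rw [hresp] at hmom
  rw [← hmom] at hc
  -- The factor `fs` undoes the scaling `T_s` in `sample`. Real parts suffice: signals and target
  -- are real, so dropping imaginary parts of the taps can only lower the error. Supports may
  -- shrink.
  let a : Fin K → ℤ →₀ ℝ := fun k => (c k).mapRange (fun z => fs * z.re) (by simp)
  have ha : ∀ k, (a k).support ⊆ (c k).support := fun k => Finsupp.support_mapRange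
  have hsum : ∀ ω, ∑ k, ∑ n ∈ (a k).support, a k n * sample fs y k n ω =
      ∑ k, ∑ n ∈ (c k).support, (c k n).re * y k (n * (1 / fs)) ω := fun ω => by
    refine Finset.sum_congr rfl fun k _ => ?_
    rw [Finset.sum_subset (ha k) fun n _ hn => by rw [Finsupp.notMem_support_iff.1 hn, zero_mul]]
    refine Finset.sum_congr rfl fun n _ => ?_
    simp only [a, Finsupp.mapRange_apply, sample]
    field_simp
  refine ⟨a, ?_⟩
  simp only [hsum]
  have hL : MemLp (fun ω => v i 0 ω - ∑ k, ∑ n ∈ (c k).support,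
      (c k n).re * y k (n * (1 / fs)) ω) 2 μ :=
    (hv.1 i 0).sub (memLp_finsetSum _ fun k _ => memLp_finsetSum _ fun n _ =>
      (hy.1 k _).const_mul _)
  have hint := (memLp_two_iff_integrable_sq hL.1).1 hL
  rw [← ENNReal.ofReal_le_ofReal_iff hε.le,
    ofReal_integral_eq_lintegral_ofReal hint (Eventually.of_forall fun ω => sq_nonneg _)]
  refine le_trans (lintegral_mono fun ω => ?_) hc
  rw [enorm_sq_eq_ofReal]
  refine ENNReal.ofReal_le_ofReal ?_
  rw [← sq_abs]
  gcongr
  refine le_trans (le_of_eq ?_) (Complex.abs_re_le_norm _)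
  simp [Complex.re_sum]

/-- The task is recovered from the samples by a digital filter with finitely many taps. -/
lemma exists_filter_integral_sq_le (hfs : 0 < fs) (hx : IsWSSWithPSD μ x C)
    (hband : ∀ f : ℝ, ((Υ : ℝ) + 1 / 2) * fs < |f| → C f = 0)
    (hΓm : ∀ i m, Measurable fun f => Γ f i m) (hHm : ∀ k m, Measurable fun f => H f k m)
    (hsuff : MaintainsSufficiency C Γ H fs Υ) (hv : IsFilterOutput μ x C Γ v)
    (hy : IsFilterOutput μ x C H y) {ε : ℝ} (hε : 0 < ε) :
    ∃ (G : ℤ → Matrix (Fin N) (Fin K) ℝ) (F : Finset ℤ), (∀ n ∉ F, G (-n) = 0) ∧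
      ∀ i, ∫ ω, (v i 0 ω - ∑ n ∈ F, ∑ k, G (-n) i k * sample fs y k n ω) ^ 2 ∂μ ≤ ε := by
  choose a ha using fun i => exists_taps_integral_sq_le hfs hx hband hΓm hHm hsuff hv hy i hε
  let F : Finset ℤ := Finset.univ.biUnion fun i => Finset.univ.biUnion fun k => (a i k).support
  have hF : ∀ i k, (a i k).support ⊆ F := fun i k n hn =>
    Finset.mem_biUnion.2 ⟨i, Finset.mem_univ i, Finset.mem_biUnion.2 ⟨k, Finset.mem_univ k, hn⟩⟩
  refine ⟨fun n => Matrix.of fun i k => a i k (-n), F, fun n hn => ?_, fun i => ?_⟩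
  · ext i k
    simp only [Matrix.of_apply, neg_neg, Matrix.zero_apply]
    exact Finsupp.notMem_support_iff.1 fun h => hn (hF i k h)
  · refine le_trans (le_of_eq (integral_congr_ae (Eventually.of_forall fun ω => ?_))) (ha i)
    simp only [Matrix.of_apply, neg_neg]
    rw [Finset.sum_comm]
    congr 2
    refine Finset.sum_congr rfl fun k _ => (Finset.sum_subset (hF i k) fun n _ hn => ?_).symm
    rw [Finsupp.notMem_support_iff.1 hn, zero_mul]

/-- The MSE of linear recovery from ever finer quantized samples vanishes. -/
lemma tendsto_achievableMSE [IsProbabilityMeasure μ] (hfs : 0 < fs) (hx : IsWSSWithPSD μ x C)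
    (hband : ∀ f : ℝ, ((Υ : ℝ) + 1 / 2) * fs < |f| → C f = 0)
    (hΓm : ∀ i m, Measurable fun f => Γ f i m) (hHm : ∀ k m, Measurable fun f => H f k m)
    (hsuff : MaintainsSufficiency C Γ H fs Υ) (hv : IsFilterOutput μ x C Γ v)
    (hy : IsFilterOutput μ x C H y) {z : ℕ → Fin K → ℤ → Ω → ℝ} {D : ℕ → ℝ}
    (hz : ∀ᶠ b in atTop, ∀ k n, AEStronglyMeasurable (z b k n) μ)
    (hyz : ∀ᶠ b in atTop, ∀ k n, ∀ᵐ ω ∂μ, |z b k n ω - sample fs y k n ω| ≤ D b)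
    (hD : Tendsto D atTop (𝓝 0)) :
    Tendsto (fun b => achievableMSE μ (fun i => v i 0) (z b)) atTop (𝓝 0) := by
  refine tendsto_order.2 ⟨fun a ha => Eventually.of_forall fun b =>
    ha.trans_le (achievableMSE_nonneg _ _), fun ε hε => ?_⟩
  set ε' : ℝ := ε / (4 * (N + 1)) with hε'
  have hε'pos : 0 < ε' := by positivity
  -- The taps depend on the tolerance only, not on `b`, so their absolute sum is a constant as `D b
  -- → 0`. The choice of `ε'` leaves a limit of `2 N ε' < ε`.
  obtain ⟨G, F, hG, hGε⟩ :=
    exists_filter_integral_sq_le hfs hx hband hΓm hHm hsuff hv hy hε'pos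
  have hlim : Tendsto (fun b => ∑ i : Fin N, (2 * ε' +
      2 * ((∑ n ∈ F, ∑ k, |G (-n) i k|) * D b) ^ 2)) atTop (𝓝 (∑ _i : Fin N, 2 * ε')) := by
    refine tendsto_finsetSum _ fun i _ => ?_
    have h := (((hD.const_mul (∑ n ∈ F, ∑ k, |G (-n) i k|)).pow 2).const_mul 2).const_add (2 * ε')
    simpa using h
  have hlt : ∑ _i : Fin N, 2 * ε' < ε := by
    rw [Finset.sum_const, Finset.card_univ, Fintype.card_fin, nsmul_eq_mul, hε']
    have : (N : ℝ) * (2 * (ε / (4 * (N + 1)))) = ε * (N / (2 * (N + 1))) := by field_simp; ring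
    rw [this]
    refine mul_lt_of_lt_one_right hε ?_
    rw [div_lt_one (by positivity)]
    linarith [(Nat.cast_nonneg N : (0 : ℝ) ≤ N)]
  filter_upwards [hz, hyz, hlim.eventually_lt_const hlt] with b hzb hyzb hb
  have hyL := fun k n => memLp_sample (fs := fs) hy.1 k n
  have hzL : ∀ k n, MemLp (z b k n) 2 μ := fun k n => by
    have := (MemLp.of_bound (p := 2) ((hzb k n).sub (hyL k n).1) _ (hyzb k n)).add (hyL k n)
    simpa using this
  refine (achievableMSE_le _ hzL G F hG).trans_lt (lt_of_le_of_lt ?_ hb)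
  refine Finset.sum_le_sum fun i _ => ?_
  have h := integral_sub_filter_sq_le (hv.1 i 0) hyL hzb hyzb F fun n k => G (-n) i k
  linarith [hGε i]

lemma achievableMSE_congr {u u' : Fin N → Ω → ℝ} (h : ∀ i, u i =ᵐ[μ] u' i)
    (z : Fin K → ℤ → Ω → ℝ) : achievableMSE μ u z = achievableMSE μ u' z := by
  have : ∀ t : Fin N → Ω → ℝ, ∑ i, ∫ ω, (u i ω - t i ω) ^ 2 ∂μ =
      ∑ i, ∫ ω, (u' i ω - t i ω) ^ 2 ∂μ := fun t => Finset.sum_congr rfl fun i _ =>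
    integral_congr_ae ((h i).mono fun ω hω => by simp only [hω])
  simp only [achievableMSE, this]

end Recovery

end

end TaskADC

/-! ### Assembly of the two claims. -/

theorem lemma2 {Ω : Type*} [MeasurableSpace Ω] (μ : Measure Ω) [IsProbabilityMeasure μ]
    {M N K : ℕ}
    -- the observed signals and their power spectral density
    (x : Fin M → ℝ → Ω → ℝ) (C : ℝ → Matrix (Fin M) (Fin M) ℂ)
    (hx : TaskADC.IsWSSWithPSD μ x C)
    -- the task, with linear MMSE estimate `(Γ * x)(0)`
    (s : Fin N → Ω → ℝ) (hs : ∀ i, MemLp (s i) 2 μ) (hs0 : ∀ i, ∫ ω, s i ω ∂μ = 0)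
    (Γ : ℝ → Matrix (Fin N) (Fin M) ℂ) (hΓm : ∀ i m, Measurable fun f => Γ f i m)
    (hΓ : TaskADC.HasLinearMMSE μ x C s Γ)
    -- arbitrary sampling rate; the input is bandlimited, possibly far beyond `fs / 2`
    (fs : ℝ) (hfs : 0 < fs) (Υ : ℕ) (hband : ∀ f : ℝ, ((Υ : ℝ) + 1 / 2) * fs < |f| → C f = 0)
    -- the analog filter and its output
    (H : ℝ → Matrix (Fin K) (Fin M) ℂ) (hHm : ∀ k m, Measurable fun f => H f k m)
    (y : Fin K → ℝ → Ω → ℝ) (hy : TaskADC.IsFilterOutput μ x C H y)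
    (hsuff : TaskADC.MaintainsSufficiency C Γ H fs Υ)
    -- for every large enough resolution `b`: dither `w b` and dynamic range `γ b`
    (η : ℝ) (hη : 0 < η) (γ : ℕ → ℝ) (w : ℕ → Fin K → ℤ → Ω → ℝ)
    (hw : ∀ᶠ b in atTop, TaskADC.IsDither μ x (TaskADC.step (γ b) b) (w b))
    (hγ : ∀ᶠ b in atTop, TaskADC.IsDynamicRange μ η
      (fun k n ω => TaskADC.sample fs y k n ω + w b k n ω) (γ b)) :
    Tendsto (fun b => TaskADC.closedFormMSE μ (TaskADC.mmse μ x s) C Γ H fs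
      (TaskADC.step (γ b) b)) atTop (𝓝 0) ∧
    ((∀ᶠ b in atTop, TaskADC.NoOverload μ
        (fun k n ω => TaskADC.sample fs y k n ω + w b k n ω) (γ b)) →
      Tendsto (fun b => TaskADC.achievableMSE μ (TaskADC.mmse μ x s)
        (fun k n ω => TaskADC.midRise (γ b) b (TaskADC.sample fs y k n ω + w b k n ω)))
        atTop (𝓝 0)) := by
  obtain ⟨v, hv, hsv⟩ := hΓ
  have hyL := fun k n => TaskADC.memLp_sample (fs := fs) hy.1 k n
  have hstep : Tendsto (fun b => TaskADC.step (γ b) b) atTop (𝓝 0) :=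
    TaskADC.tendsto_step hyL hw hγ
  have hpos : ∀ᶠ b in atTop, 0 < TaskADC.step (γ b) b :=
    hγ.mono fun b hb => TaskADC.step_pos hb.1 b
  have hfin := fun i => hv.totalEnergy_ne_top hx hΓm i
  refine ⟨?_, fun hno => ?_⟩
  · have hu : ∀ i, ∫ ω, TaskADC.mmse μ x s i ω ^ 2 ∂μ =
        (TaskADC.totalEnergy C (fun f => Γ f i)).toReal := fun i => by
      rw [← hv.integral_sq hx hΓm i]
      exact integral_congr_ae ((hsv i).mono fun ω hω => by simp only [hω])
    have hδ : ∀ᶠ b in atTop, 0 < fs * TaskADC.step (γ b) b ^ 2 / 4 :=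
      hpos.mono fun b hb => by positivity
    have hlim : Tendsto (fun b => fs * TaskADC.step (γ b) b ^ 2 / 4) atTop (𝓝 0) := by
      simpa using ((hstep.pow 2).const_mul fs).div_const 4
    have h := tendsto_finsetSum Finset.univ fun i (_ : i ∈ Finset.univ) =>
      TaskADC.tendsto_integral_aliasMin hx hfs hband hΓm hHm hsuff i (hfin i) hδ hlim
    rw [Finset.sum_const_zero] at h
    -- The closed form equals the ridge integral only for `Δ > 0`, which holds for all large `b`.
    refine h.congr' (hpos.mono fun b hb => ?_)
    exact (TaskADC.closedFormMSE_eq hx hfs hband hΓm hHm hfin hu hb).symm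
  · simp only [TaskADC.achievableMSE_congr hsv]
    refine TaskADC.tendsto_achievableMSE hfs hx hband hΓm hHm hsuff hv hy
      (D := fun b => 3 / 2 * TaskADC.step (γ b) b) ?_ ?_ (by simpa using hstep.const_mul (3 / 2))
    · filter_upwards [hw] with b hb k n
      exact ((TaskADC.measurable_midRise _ _).comp_aemeasurable
        ((hyL k n).1.aemeasurable.add (hb.measurable k n).aemeasurable)).aestronglyMeasurable
    · filter_upwards [hw, hγ, hno] with b hwb hγb hnob k n
      exact TaskADC.ae_abs_midRise_sub_le hγb.1 hwb hnob k n
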